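/- **Theorem.** Work in $\mathrm{ZF}$ without Regularity, in the language $\{\in,E\}$ with a new binary predicate symbol $E$ (Separation and Replacement are assumed for all formulas of this language), and assume BF: $E$ is a best-founded relation on the universe $V$. That is, every nonempty set $s$ has an $E$-minimal element (an $m\in s$ with $\neg(y\,E\,m)$ for all $y\in s\setminus\{m\}$), every $x$ has an ordinal rank $\mathrm{rk}_E(x)=\sup\{\mathrm{rk}_E(y)+1 : y\,E\,x,\ y\neq x\}$, and $\{x:\mathrm{rk}_E(x)=\alpha\}$ is a set for every ordinal $\alpha$. Put $U_\alpha=\{x:\mathrm{rk}_E(x)<\alpha\}$. For a language $L$, let $OD_L$ be the class of all sets of the form $\{u:\varphi(u,\alpha_1,\dots,\alpha_n)\}$, where $\varphi$ is an $L$-formula and $\alpha_1,\dots,\alpha_n$ are ordinals. The classical Gödel operations are $\{X,Y\}$, $X\times Y$, $\{(u,v)\in X\times Y:u\in v\}$, $X\setminus Y$, $X\cap Y$, $\bigcup X$, $\mathrm{dom}\,X$, $\{(u,v):(v,u)\in X\}$, $\{(u,v,w):(u,w,v)\in X\}$, $\{(u,v,w):(v,w,u)\in X\}$; the Gödel operations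 for $\{\in,E\}$ are these together with $\{(u,v)\in X\times Y:u\,E\,v\}$. Let $\mathrm{cl}_L(S)$ be the least ($L$-definable with parameters) class that includes $S$ and is closed under the Gödel operations for $L$ (the classical ones if $L=\{\in\}$). Then: 1. $OD_{\{\in,E\}}=\mathrm{cl}_{\{\in,E\}}(\{U_\alpha:\alpha\in Ord\})$. 2. If moreover $E$ is definable by a formula of the language $\{\in\}$ without parameters (for instance if $E$ is $\in$ itself, as under Regularity, where $U_\alpha=V_\alpha$), then $OD_{\{\in\}}=\mathrm{cl}_{\{\in\}}(\{U_\alpha:\alpha\in Ord\})$, with the classical Gödel operations. These statements hold in every model $(M,\in,E)$ of the stated axioms, where "formula" means an actual first-order formula and ordinals, operations and classes are those of $M$. -/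

import Mathlib

/-- The relation symbols of the language of set theory: membership. -/
inductive MemSymbol : ℕ → Type
  | mem : MemSymbol 2

/-- The relation symbols of the language of set theory with one new binary predicate symbol `E`. -/
inductive MemESymbol : ℕ → Type
  | mem : MemESymbol 2
  | rel : MemESymbol 2

/-- The first-order language `{∈}`. -/
def LMem : FirstOrder.Language.{0, 0} := ⟨fun _ => Empty, MemSymbol⟩

/-- The first-order language `{∈, E}`. -/
def LMemE : FirstOrder.Language.{0, 0} := ⟨fun _ => Empty, MemESymbol⟩

/-- A structure `(M, ∈, E)` for the language `{∈, E}`. -/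
class SetStr (M : Type*) where
  mem : M → M → Prop
  rel : M → M → Prop

infix:50 " ∈ₘ " => SetStr.mem
infix:50 " ≺ₑ " => SetStr.rel

namespace SetStr

variable {M : Type*} [SetStr M]

instance instLMem : LMem.Structure M where
  funMap f := Empty.elim f
  RelMap r v := match r with
    | MemSymbol.mem => v 0 ∈ₘ v 1

instance instLMemE : LMemE.Structure M where
  funMap f := Empty.elim f
  RelMap r v := match r with
    | MemESymbol.mem => v 0 ∈ₘ v 1
    | MemESymbol.rel => v 0 ≺ₑ v 1

/-! ### Basic set-theoretic notions, all relative to the structure `M` -/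

/-- `z = {x, y}`. -/
def IsPair (x y z : M) : Prop := ∀ w, w ∈ₘ z ↔ w = x ∨ w = y

/-- `p = (x, y) = {{x}, {x, y}}`. -/
def IsOPair (x y p : M) : Prop :=
  ∃ a b, IsPair x x a ∧ IsPair x y b ∧ IsPair a b p

/-- `p = (x, y, z) = ((x, y), z)`. -/
def IsTriple (x y z p : M) : Prop := ∃ q, IsOPair x y q ∧ IsOPair q z p

/-- `α` is a (von Neumann) ordinal: a transitive set well-ordered by `∈`. Well-foundedness is
demanded explicitly because Regularity is not available. -/
def IsOrd (α : M) : Prop :=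
  (∀ x y, x ∈ₘ y → y ∈ₘ α → x ∈ₘ α) ∧
  (∀ x y, x ∈ₘ α → y ∈ₘ α → x ∈ₘ y ∨ x = y ∨ y ∈ₘ x) ∧
  (∀ s, (∃ x, x ∈ₘ s) → (∀ x, x ∈ₘ s → x ∈ₘ α) → ∃ m, m ∈ₘ s ∧ ∀ x, x ∈ₘ s → ¬ x ∈ₘ m)

variable (M) in
/-- The class of all ordinals of `M`. -/
def Ords : Set M := {α | IsOrd α}

variable (M) in
/-- `(M, ∈, E)` is a model of `ZF` minus Regularity, with Separation and Replacement for all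
formulas (with parameters) of the language `{∈, E}`. -/
structure IsModelZFWithoutRegularity : Prop where
  extensionality : ∀ x y : M, (∀ z, z ∈ₘ x ↔ z ∈ₘ y) → x = y
  pairing : ∀ x y : M, ∃ z, IsPair x y z
  union : ∀ x : M, ∃ z, ∀ w, w ∈ₘ z ↔ ∃ y, y ∈ₘ x ∧ w ∈ₘ y
  powerset : ∀ x : M, ∃ z, ∀ w, w ∈ₘ z ↔ ∀ u, u ∈ₘ w → u ∈ₘ x
  infinity : ∃ z : M, (∃ e, e ∈ₘ z ∧ ∀ w, ¬ w ∈ₘ e) ∧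
    ∀ x, x ∈ₘ z → ∃ y, y ∈ₘ z ∧ ∀ w, w ∈ₘ y ↔ w ∈ₘ x ∨ w = x
  separation : ∀ S : Set M, (Set.univ : Set M).Definable₁ LMemE S →
    ∀ a : M, ∃ b, ∀ x, x ∈ₘ b ↔ x ∈ₘ a ∧ x ∈ S
  replacement : ∀ R : Set (M × M), (Set.univ : Set M).Definable₂ LMemE R →
    ∀ a : M, (∀ x y z, x ∈ₘ a → (x, y) ∈ R → (x, z) ∈ R → y = z) →
      ∃ b, ∀ y, y ∈ₘ b ↔ ∃ x, x ∈ₘ a ∧ (x, y) ∈ R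

/-! ### Best-founded relations -/

/-- `f(x) = y`, for a set `f` of ordered pairs. -/
def App (f x y : M) : Prop := ∃ p, p ∈ₘ f ∧ IsOPair x y p

/-- `f` is a function with ordinal values whose domain is closed under `E`-predecessors, and
`f(x) = sup {f(y) + 1 : y E x, y ≠ x}` for all `x` in its domain. -/
def IsRankFun (f : M) : Prop :=
  (∀ x α, App f x α → IsOrd α) ∧
  (∀ x α β, App f x α → App f x β → α = β) ∧
  (∀ x α y, App f x α → y ≺ₑ x → ∃ β, App f y β) ∧
  (∀ x α, App f x α →
    ∀ ξ, ξ ∈ₘ α ↔ ∃ y β, y ≺ₑ x ∧ y ≠ x ∧ App f y β ∧ (ξ ∈ₘ β ∨ ξ = β))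

/-- `rk_E(x) = α`. -/
def HasRank (x α : M) : Prop := ∃ f, IsRankFun f ∧ App f x α

variable (M) in
/-- Every nonempty set has an `E`-minimal element (loops `x E x` are ignored). -/
def IsWellFounded : Prop :=
  ∀ s : M, (∃ x, x ∈ₘ s) → ∃ m, m ∈ₘ s ∧ ∀ y, y ∈ₘ s → y ≠ m → ¬ y ≺ₑ m

variable (M) in
/-- `E` is a best-founded relation on the universe: it is well-founded, it has a rank function
into the ordinals, and the sets of any given rank form a set. -/
structure IsBestFounded : Prop where
  wellFounded : IsWellFounded M
  rank_exists : ∀ x : M, ∃ α, HasRank x α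
  level_isSet : ∀ α : M, IsOrd α → ∃ s : M, ∀ x, x ∈ₘ s ↔ HasRank x α

/-- `u = U_α = {x : rk_E(x) < α}`. -/
def IsSegment (α u : M) : Prop := ∀ x, x ∈ₘ u ↔ ∃ β, β ∈ₘ α ∧ HasRank x β

variable (M) in
/-- The class `{U_α : α ∈ Ord}`. -/
def Segments : Set M := {u | ∃ α, IsOrd α ∧ IsSegment α u}

/-! ### Ordinal definability -/

variable (M) in
/-- The class of ordinal-definable sets: those `a` of the form `{u : φ(u, α, …)}` for an
`L`-formula `φ` and ordinals `α, …`. -/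
def OD (L : FirstOrder.Language) [L.Structure M] : Set M :=
  {a | (Ords M).Definable₁ L {u | u ∈ₘ a}}

/-! ### Gödel operations

Each operation is given by its graph: the relation `G X Y Z` says that `Z` is the value at `X, Y`
(operations of one argument ignore `Y`). -/

/-- `{X, Y}` -/
def GPair (X Y Z : M) : Prop := IsPair X Y Z

/-- `X × Y` -/
def GProd (X Y Z : M) : Prop :=
  ∀ p, p ∈ₘ Z ↔ ∃ u v, u ∈ₘ X ∧ v ∈ₘ Y ∧ IsOPair u v p

/-- `{(u, v) : u ∈ X, v ∈ Y, u ∈ v}` -/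
def GMem (X Y Z : M) : Prop :=
  ∀ p, p ∈ₘ Z ↔ ∃ u v, u ∈ₘ X ∧ v ∈ₘ Y ∧ u ∈ₘ v ∧ IsOPair u v p

/-- `X \ Y` -/
def GDiff (X Y Z : M) : Prop := ∀ u, u ∈ₘ Z ↔ u ∈ₘ X ∧ ¬ u ∈ₘ Y

/-- `X ∩ Y` -/
def GInter (X Y Z : M) : Prop := ∀ u, u ∈ₘ Z ↔ u ∈ₘ X ∧ u ∈ₘ Y

/-- `⋃ X` -/
def GUnion (X _Y Z : M) : Prop := ∀ u, u ∈ₘ Z ↔ ∃ x, x ∈ₘ X ∧ u ∈ₘ x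

/-- `dom X = {u : ∃ v, (u, v) ∈ X}` -/
def GDom (X _Y Z : M) : Prop := ∀ u, u ∈ₘ Z ↔ ∃ v, App X u v

/-- `{(u, v) : (v, u) ∈ X}` -/
def GSwap (X _Y Z : M) : Prop := ∀ p, p ∈ₘ Z ↔ ∃ u v, App X v u ∧ IsOPair u v p

/-- `{(u, v, w) : (u, w, v) ∈ X}` -/
def GTransp (X _Y Z : M) : Prop :=
  ∀ p, p ∈ₘ Z ↔ ∃ u v w q, q ∈ₘ X ∧ IsTriple u w v q ∧ IsTriple u v w p

/-- `{(u, v, w) : (v, w, u) ∈ X}` -/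
def GCycle (X _Y Z : M) : Prop :=
  ∀ p, p ∈ₘ Z ↔ ∃ u v w q, q ∈ₘ X ∧ IsTriple v w u q ∧ IsTriple u v w p

/-- `{(u, v) : u ∈ X, v ∈ Y, u E v}`, the analogue of `GMem` for the predicate symbol `E`. -/
def GRel (X Y Z : M) : Prop :=
  ∀ p, p ∈ₘ Z ↔ ∃ u v, u ∈ₘ X ∧ v ∈ₘ Y ∧ u ≺ₑ v ∧ IsOPair u v p

variable (M) in
/-- The ten classical Gödel operations. -/
def godelOps : Set (M → M → M → Prop) :=
  {GPair, GProd, GMem, GDiff, GInter, GUnion, GDom, GSwap, GTransp, GCycle}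

variable (M) in
/-- The Gödel operations for the language `{∈, E}`. -/
def godelOpsE : Set (M → M → M → Prop) := insert GRel (godelOps M)

/-- The class `C` is closed under the operations in `ops`. -/
def ClosedUnder (ops : Set (M → M → M → Prop)) (C : Set M) : Prop :=
  ∀ G ∈ ops, ∀ X Y Z, X ∈ C → Y ∈ C → G X Y Z → Z ∈ C

/-- The closure of the class `S` under `ops`, as computed in `M`: the least class that includes `S`
and is closed under `ops`. The classes of `M` are the subsets that are definable by an `L`-formula
with parameters. -/
def cl (L : FirstOrder.Language) [L.Structure M] (ops : Set (M → M → M → Prop))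
    (S : Set M) : Set M :=
  {x | ∀ C : Set M, (Set.univ : Set M).Definable₁ L C → S ⊆ C → ClosedUnder ops C → x ∈ C}

end SetStr

/-!
Ordinal definability and the closure of the segments `U_α` under the Gödel operations, in a model
`(M, ∈, E)` of `ZF` without Regularity whose relation `E` is best-founded.

For `OD ⊆ cl`, let `C` be a class that includes the segments and is closed under the operations.
By induction on the formula (`Local.formula`), the restriction to any segment `U_β` of a relation
definable with parameters from `C`, coded as a set of tuples, belongs to `C`. No reflection is
needed: for the existential quantifier, Collection yields a segment `U_γ` that contains witnesses
for all tuples from `U_β`, and the restriction to `U_β` is cut out of the domain of the restriction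
to `U_γ` (`Local.ex`). Hence every set definable with parameters from `C` belongs to `C`
(`mem_of_definable`). Ordinals may serve as parameters: the ranks of the elements of `U_α` are the
elements of `α`, so `α` is definable from `U_α` (`IsSegment.ord_unique`) and belongs to `C`
(`ords_subset`).

For `cl ⊆ OD`, what is needed is a definable class of ordinal definable sets that is closed under
the operations; that `OD` itself is such a class is not obvious, as formulas are external objects.
The class used is the range of a function `Enum` on (some of) the ordinals, defined by recursion
without parameters. At stage `ξ` it takes the first pair of indices `β, γ` at which one of the
operations has a value not yet enumerated, where the operations are applied to the sets with the
indices `β` and `γ`, and `U_β` counts as one more value. Nothing is enumerated twice. If a value at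
some indices below `δ₀` were never enumerated, then all stages beyond `δ₀` would enumerate values at
indices below `δ₀`, and a proper class of stages would inject into a set (`exists_enum`). Each
enumerated set is definable from its index (`Enum.mem_OD`).

If `E` is definable from `∈`, both arguments go through for the language of `∈` alone: the range of
`Enum` is still definable, and formulas do not mention `E`.
-/

namespace SetStr

open Set FirstOrder

-- Formulas that define predicates are found by instance search, in as many steps as the formula has
-- connectives, quantifiers and variables.
set_option synthInstance.maxSize 100000
set_option synthInstance.maxHeartbeats 2000000

/-! ### Definable predicates and definable functions -/

section Definability

variable {M : Type*}

/-- Both `∈` and `E` are definable without parameters in the language `L`. -/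
class DefStr (L : Language) (M : Type*) [SetStr M] [L.Structure M] : Prop where
  mem : (∅ : Set M).Definable L {v : Fin 2 → M | v 0 ∈ₘ v 1}
  rel : (∅ : Set M).Definable L {v : Fin 2 → M | v 0 ≺ₑ v 1}

variable (L : Language) [L.Structure M] (A : Set M)

/-- The predicate `P` of assignments is `L`-definable with parameters from `A`. As a class, it
lets instance search build a defining formula along the shape of `P`. -/
class DefP {α : Type} (P : (α → M) → Prop) : Prop where
  out : A.Definable L {v | P v}

/-- The function `t` of assignments is `L`-definable with parameters from `A`. -/
class DefT {α : Type} (t : (α → M) → M) : Prop where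
  out : A.DefinableFun L t

/-- `e` restricts assignments along a map of variables. -/
class Restr {α β : Type} (e : (α → M) → (β → M)) : Prop where
  out : ∃ f : β → α, ∀ v i, e v i = v (f i)

variable {L A} {α β : Type}

instance Restr.self : Restr (fun v : α → M => v) := ⟨id, fun _ _ => rfl⟩

instance Restr.inl (e : (α → M) → (β ⊕ Fin 1 → M)) [h : Restr e] :
    Restr (fun w => e w ∘ Sum.inl) := by
  obtain ⟨f, hf⟩ := h.out
  exact ⟨f ∘ Sum.inl, fun v i => hf v _⟩

instance DefT.var (e : (α → M) → (β → M)) [h : Restr e] (i : β) :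
    DefT L A (fun v => e v i) := by
  obtain ⟨f, hf⟩ := h.out
  refine ⟨?_⟩
  simp only [hf]
  exact DefinableFun.proj L

theorem DefT.const {c : M} (hc : c ∈ A) : DefT L A (fun _ : α → M => c) :=
  ⟨FirstOrder.Language.definableFun_const L α hc⟩

instance DefT.const_univ (c : M) : DefT L univ (fun _ : α → M => c) := DefT.const (mem_univ c)

instance DefT.restr (t : (β → M) → M) (e : (α → M) → (β → M)) [h : DefT L A t] [he : Restr e] :
    DefT L A (fun v => t (e v)) := by
  obtain ⟨f, hf⟩ := he.out
  refine ⟨?_⟩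
  have := h.out.preimage_comp (fun i : Option β => i.map f)
  unfold DefinableFun
  convert! this using 1
  ext v
  simp only [Function.tupleGraph, mem_preimage, mem_ofPred_eq]
  have : e (v ∘ some) = ((v ∘ fun i => Option.map f i) ∘ some) := by
    funext i; simp [hf]
  simp [← this]

theorem DefP.restr (P : (β → M) → Prop) (e : (α → M) → (β → M)) [h : DefP L A P] [he : Restr e] :
    DefP L A (fun v => P (e v)) := by
  obtain ⟨f, hf⟩ := he.out
  refine ⟨?_⟩
  convert! h.out.preimage_comp f using 1
  ext v
  simp only [mem_preimage, mem_ofPred_eq]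
  rw [show e v = v ∘ f from funext (hf v)]

theorem DefP.mono {B : Set M} (hAB : A ⊆ B) {P : (α → M) → Prop} (h : DefP L A P) : DefP L B P :=
  ⟨h.out.mono hAB⟩

/-- Definable functions may be substituted into definable relations. -/
theorem DefP.subst {k : ℕ} {Q : (Fin k → M) → Prop} (h : DefP L A Q)
    {t : Fin k → (α → M) → M} (ht : ∀ i, DefT L A (t i)) : DefP L A (fun v => Q (fun i => t i v)) :=
  ⟨Definable.preimage_map (F := fun v i => t i v) (fun i => (ht i).out) h.out⟩

instance DefP.and (P Q : (α → M) → Prop) [hP : DefP L A P] [hQ : DefP L A Q] :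
    DefP L A (fun v => P v ∧ Q v) := ⟨hP.out.inter hQ.out⟩

instance DefP.or (P Q : (α → M) → Prop) [hP : DefP L A P] [hQ : DefP L A Q] :
    DefP L A (fun v => P v ∨ Q v) := ⟨hP.out.union hQ.out⟩

instance DefP.not (P : (α → M) → Prop) [hP : DefP L A P] :
    DefP L A (fun v => ¬ P v) := ⟨hP.out.compl⟩

instance DefP.imp (P Q : (α → M) → Prop) [hP : DefP L A P] [hQ : DefP L A Q] :
    DefP L A (fun v => P v → Q v) := by
  have : DefP L A (fun v => ¬ P v ∨ Q v) := inferInstance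
  simpa only [← imp_iff_not_or] using this

instance DefP.iff (P Q : (α → M) → Prop) [hP : DefP L A P] [hQ : DefP L A Q] :
    DefP L A (fun v => P v ↔ Q v) := by
  simp only [iff_def]; infer_instance

instance DefP.const (p : Prop) : DefP L A (fun _ : α → M => p) := by
  by_cases hp : p
  · exact ⟨by simp [hp]⟩
  · exact ⟨by simp [hp]⟩

theorem DefP.exists_tuple {k : ℕ} (P : (α → M) → (Fin k → M) → Prop)
    (h : DefP L A (fun w : α ⊕ Fin k → M => P (w ∘ Sum.inl) (w ∘ Sum.inr))) :
    DefP L A (fun v => ∃ x : Fin k → M, P v x) := by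
  refine ⟨?_⟩
  convert! h.out.exists_of_finite using 1

instance DefP.ex (P : (α → M) → M → Prop)
    [h : DefP L A (fun w : α ⊕ Fin 1 → M => P (w ∘ Sum.inl) (w (Sum.inr 0)))] :
    DefP L A (fun v => ∃ y : M, P v y) := by
  have := DefP.exists_tuple (L := L) (A := A) (fun v x => P v (x (0 : Fin 1))) h
  refine ⟨?_⟩
  convert! this.out using 1
  ext v
  exact ⟨fun ⟨y, hy⟩ => ⟨fun _ => y, hy⟩, fun ⟨x, hx⟩ => ⟨x 0, hx⟩⟩

instance DefP.all (P : (α → M) → M → Prop)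
    [h : DefP L A (fun w : α ⊕ Fin 1 → M => P (w ∘ Sum.inl) (w (Sum.inr 0)))] :
    DefP L A (fun v => ∀ y : M, P v y) := by
  have : DefP L A (fun v => ¬ ∃ y : M, ¬ P v y) := inferInstance
  simpa only [not_exists, not_not] using this

instance DefP.eq (t s : (α → M) → M) [ht : DefT L A t] [hs : DefT L A s] :
    DefP L A (fun v => t v = s v) := ⟨ht.out.ofPred_eq hs.out⟩

theorem DefP.subst₂ {Q : M → M → Prop} (h : DefP L A (fun v : Fin 2 → M => Q (v 0) (v 1)))
    (t s : (α → M) → M) [ht : DefT L A t] [hs : DefT L A s] : DefP L A (fun v => Q (t v) (s v)) :=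
  DefP.subst h (t := ![t, s]) (by intro i; fin_cases i <;> assumption)

theorem DefP.subst₃ {Q : M → M → M → Prop} (h : DefP L A (fun v : Fin 3 → M => Q (v 0) (v 1) (v 2)))
    (t s r : (α → M) → M) [ht : DefT L A t] [hs : DefT L A s] [hr : DefT L A r] :
    DefP L A (fun v => Q (t v) (s v) (r v)) :=
  DefP.subst h (t := ![t, s, r]) (by intro i; fin_cases i <;> assumption)

variable [SetStr M] [hL : DefStr L M]

instance DefP.mem (t s : (α → M) → M) [DefT L A t] [DefT L A s] :
    DefP L A (fun v => t v ∈ₘ s v) :=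
  DefP.subst₂ ⟨hL.mem.mono (empty_subset A)⟩ t s

instance DefP.rel (t s : (α → M) → M) [DefT L A t] [DefT L A s] :
    DefP L A (fun v => t v ≺ₑ s v) :=
  DefP.subst₂ ⟨hL.rel.mono (empty_subset A)⟩ t s

section
variable (t s r : (α → M) → M) [DefT L A t] [DefT L A s] [DefT L A r]

instance DefP.isPair : DefP L A (fun v => IsPair (t v) (s v) (r v)) := by
  unfold IsPair; infer_instance

instance DefP.isOPair : DefP L A (fun v => IsOPair (t v) (s v) (r v)) := by
  unfold IsOPair; infer_instance

instance DefP.isOrd : DefP L A (fun v => IsOrd (t v)) := by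
  unfold IsOrd; infer_instance

instance DefP.app : DefP L A (fun v => App (t v) (s v) (r v)) := by
  unfold App; infer_instance

instance DefP.isRankFun : DefP L A (fun v => IsRankFun (t v)) := by
  unfold IsRankFun; infer_instance

instance DefP.hasRank : DefP L A (fun v => HasRank (t v) (s v)) := by
  unfold HasRank; infer_instance

instance DefP.isSegment : DefP L A (fun v => IsSegment (t v) (s v)) := by
  unfold IsSegment; infer_instance

end

end Definability

/-! ### Elementary set theory in a model -/

section Sets

variable {M : Type*} [SetStr M]

instance : DefStr LMemE M where
  mem := by
    refine empty_definable_iff.2 ⟨Language.Relations.formula₂ (L := LMemE) MemESymbol.mem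
      (Language.Term.var 0) (Language.Term.var 1), ?_⟩
    ext v
    exact Iff.rfl
  rel := by
    refine empty_definable_iff.2 ⟨Language.Relations.formula₂ (L := LMemE) MemESymbol.rel
      (Language.Term.var 0) (Language.Term.var 1), ?_⟩
    ext v
    exact Iff.rfl

variable [hZF : Fact (IsModelZFWithoutRegularity M)]

theorem ext_iff' {x y : M} : x = y ↔ ∀ z, z ∈ₘ x ↔ z ∈ₘ y :=
  ⟨by rintro rfl; exact fun _ => Iff.rfl, hZF.out.extensionality x y⟩

theorem ext_of {P : M → Prop} {x y : M} (hx : ∀ z, z ∈ₘ x ↔ P z) (hy : ∀ z, z ∈ₘ y ↔ P z) :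
    x = y := ext_iff'.2 fun z => (hx z).trans (hy z).symm

theorem exists_sep (P : M → Prop) (a : M)
    (h : DefP LMemE univ (fun v : Fin 1 → M => P (v 0)) := by infer_instance) :
    ∃ b, ∀ x, x ∈ₘ b ↔ x ∈ₘ a ∧ P x := hZF.out.separation {x | P x} h.out a

theorem exists_image (R : M → M → Prop) (a : M)
    (hR : ∀ x, x ∈ₘ a → ∀ y z, R x y → R x z → y = z)
    (h : DefP LMemE univ (fun v : Fin 2 → M => R (v 0) (v 1)) := by infer_instance) :
    ∃ b, ∀ y, y ∈ₘ b ↔ ∃ x, x ∈ₘ a ∧ R x y :=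
  hZF.out.replacement {p | R p.1 p.2} h.out a fun x y z hx => hR x hx y z

/-- There is no universal set: Russell's paradox. -/
theorem not_forall_mem (a : M) : ¬ ∀ x, x ∈ₘ a := by
  intro h
  obtain ⟨b, hb⟩ := exists_sep (fun x : M => ¬ x ∈ₘ x) a
  have := hb b
  have := h b
  tauto

variable (M) in
theorem exists_empty : ∃ e : M, ∀ x, ¬ x ∈ₘ e := by
  obtain ⟨_, ⟨e, -, he⟩, -⟩ := hZF.out.infinity
  exact ⟨e, he⟩

variable (M) in
/-- The empty set of `M`. -/
noncomputable def emp : M := (exists_empty M).choose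

theorem not_mem_emp (x : M) : ¬ x ∈ₘ emp M := (exists_empty M).choose_spec x

/-- The unordered pair `{x, y}`. -/
noncomputable def upair (x y : M) : M := (hZF.out.pairing x y).choose

theorem mem_upair {x y w : M} : w ∈ₘ upair x y ↔ w = x ∨ w = y :=
  (hZF.out.pairing x y).choose_spec w

theorem isPair_iff {x y z : M} : IsPair x y z ↔ z = upair x y :=
  ⟨fun h => ext_of h fun _ => mem_upair, by rintro rfl; exact fun _ => mem_upair⟩

/-- The ordered pair `(x, y)`. -/
noncomputable def opair (x y : M) : M := upair (upair x x) (upair x y)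

theorem isOPair_iff {x y p : M} : IsOPair x y p ↔ p = opair x y := by
  simp [IsOPair, isPair_iff, opair]

theorem upair_inj_left {x y z : M} (h : upair x y = upair x z) : y = z := by
  have h1 : ∀ w, w = x ∨ w = y ↔ w = x ∨ w = z := fun w => by
    rw [← mem_upair, ← mem_upair, h]
  have := h1 y
  have := h1 z
  grind

theorem upair_self_inj {x y z : M} (h : upair x x = upair y z) : x = y ∧ x = z := by
  have h1 : ∀ w, w = x ∨ w = x ↔ w = y ∨ w = z := fun w => by
    rw [← mem_upair, ← mem_upair, h]
  have := h1 y
  have := h1 z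
  grind

theorem opair_inj {x y x' y' : M} : opair x y = opair x' y' ↔ x = x' ∧ y = y' := by
  refine ⟨fun h => ?_, by rintro ⟨rfl, rfl⟩; rfl⟩
  have hx : x = x' := by
    have : upair x x ∈ₘ opair x' y' := by rw [← h]; exact mem_upair.2 (Or.inl rfl)
    rcases mem_upair.1 this with h | h
    · exact (upair_self_inj h).1
    · exact (upair_self_inj h).1
  subst hx
  exact ⟨rfl, upair_inj_left (upair_inj_left h)⟩

theorem isTriple_iff {x y z p : M} : IsTriple x y z p ↔ p = opair (opair x y) z := by
  simp [IsTriple, isOPair_iff]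

theorem app_iff {f x y : M} : App f x y ↔ opair x y ∈ₘ f := by
  simp [App, isOPair_iff]

instance DefT.opair {L : Language} [L.Structure M] {A : Set M} [DefStr L M] {α : Type}
    (t s : (α → M) → M) [ht : DefT L A t] [hs : DefT L A s] :
    DefT L A (fun v => opair (t v) (s v)) := by
  have h : DefP L A (fun v : Fin 3 → M => IsOPair (v 0) (v 1) (v 2)) := inferInstance
  have : DefT L A (fun v : Fin 2 → M => SetStr.opair (v 0) (v 1)) := by
    refine ⟨?_⟩
    have := h.out.preimage_comp (fun i : Fin 3 => ![some (0 : Fin 2), some 1, none] i)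
    unfold DefinableFun
    convert! this using 1
    ext v
    simp [Function.tupleGraph, isOPair_iff, eq_comm]
  refine ⟨?_⟩
  exact DefinableFun.comp (g := fun v i => ![t, s] i v)
    (by intro i; fin_cases i; exacts [ht.out, hs.out]) this.out

theorem exists_sUnion (a : M) : ∃ z, ∀ w, w ∈ₘ z ↔ ∃ y, y ∈ₘ a ∧ w ∈ₘ y := hZF.out.union a

theorem exists_union (a b : M) : ∃ z, ∀ w, w ∈ₘ z ↔ w ∈ₘ a ∨ w ∈ₘ b := by
  obtain ⟨z, hz⟩ := exists_sUnion (upair a b)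
  exact ⟨z, fun w => by simp [hz, mem_upair]⟩

/-- The union of a definable family of sets indexed by a set. -/
theorem exists_iUnion (R : M → M → Prop) (a : M)
    (hR : ∀ x, x ∈ₘ a → ∃ s, ∀ y, y ∈ₘ s ↔ R x y)
    (h : DefP LMemE univ (fun v : Fin 2 → M => R (v 0) (v 1)) := by infer_instance) :
    ∃ b, ∀ y, y ∈ₘ b ↔ ∃ x, x ∈ₘ a ∧ R x y := by
  have h' {α : Type} (t s : (α → M) → M) [DefT LMemE univ t] [DefT LMemE univ s] :
    DefP LMemE univ (fun v => R (t v) (s v)) := DefP.subst₂ h t s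
  obtain ⟨c, hc⟩ := exists_image (fun x s => ∀ y, y ∈ₘ s ↔ R x y) a
    (fun x _ s s' hs hs' => ext_of hs hs')
  obtain ⟨b, hb⟩ := exists_sUnion c
  refine ⟨b, fun y => ?_⟩
  rw [hb]
  constructor
  · rintro ⟨s, hs, hy⟩
    obtain ⟨x, hx, h⟩ := (hc s).1 hs
    exact ⟨x, hx, (h y).1 hy⟩
  · rintro ⟨x, hx, hy⟩
    obtain ⟨s, hs⟩ := hR x hx
    exact ⟨s, (hc s).2 ⟨x, hx, hs⟩, (hs y).2 hy⟩

/-- A definable subclass of a Cartesian product of two sets is a set. -/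
theorem exists_subset_prod (P : M → Prop) (a b : M)
    (h : DefP LMemE univ (fun v : Fin 1 → M => P (v 0)) := by infer_instance) :
    ∃ c, ∀ p, p ∈ₘ c ↔ ∃ u v, u ∈ₘ a ∧ v ∈ₘ b ∧ P p ∧ p = opair u v := by
  obtain ⟨c, hc⟩ := exists_iUnion (fun u p => ∃ v, v ∈ₘ b ∧ p = opair u v) a
    (fun u _ => by
      obtain ⟨s, hs⟩ := exists_image (fun v p => p = opair u v) b
        (by rintro x - y z rfl rfl; rfl)
      exact ⟨s, hs⟩)
  obtain ⟨d, hd⟩ := exists_sep P c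
  refine ⟨d, fun p => ?_⟩
  rw [hd, hc]
  grind

end Sets

/-! ### Ordinals of a model -/

section Ordinals

variable {M : Type*} [SetStr M] [hZF : Fact (IsModelZFWithoutRegularity M)] {α β γ x y z : M}

omit hZF in
theorem IsOrd.trans (h : IsOrd α) (hxy : x ∈ₘ y) (hy : y ∈ₘ α) : x ∈ₘ α := h.1 x y hxy hy

theorem IsOrd.not_mem_self_of_mem (h : IsOrd α) (hx : x ∈ₘ α) : ¬ x ∈ₘ x := by
  obtain ⟨m, hm, hmin⟩ := h.2.2 (upair x x) ⟨x, mem_upair.2 (Or.inl rfl)⟩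
    (by simp [mem_upair, hx])
  grind [mem_upair]

theorem IsOrd.not_mem_self (h : IsOrd α) : ¬ α ∈ₘ α := fun hα => h.not_mem_self_of_mem hα hα

theorem IsOrd.not_mem_of_mem (h : IsOrd α) (hx : x ∈ₘ α) (hy : y ∈ₘ α) (hxy : x ∈ₘ y) :
    ¬ y ∈ₘ x := by
  obtain ⟨m, hm, hmin⟩ := h.2.2 (upair x y) ⟨x, mem_upair.2 (Or.inl rfl)⟩
    (by simp [mem_upair, hx, hy])
  grind [mem_upair]

theorem IsOrd.mem_trans (h : IsOrd α) (hx : x ∈ₘ α) (hy : y ∈ₘ α) (hz : z ∈ₘ α)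
    (hxy : x ∈ₘ y) (hyz : y ∈ₘ z) : x ∈ₘ z := by
  rcases h.2.1 x z hx hz with h1 | rfl | h1
  · exact h1
  · exact absurd hyz (h.not_mem_of_mem hx hy hxy)
  · obtain ⟨s, hs⟩ := exists_union (upair x y) (upair z z)
    obtain ⟨m, hm, hmin⟩ := h.2.2 s ⟨x, (hs x).2 (Or.inl (mem_upair.2 (Or.inl rfl)))⟩
      (by simp only [hs, mem_upair]; grind)
    grind [mem_upair]

theorem IsOrd.of_mem (h : IsOrd α) (hx : x ∈ₘ α) : IsOrd x := by
  refine ⟨fun y z hyz hz => ?_, fun y z hy hz => h.2.1 y z (h.trans hy hx) (h.trans hz hx),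
    fun s hs hsx => h.2.2 s hs fun y hy => h.trans (hsx y hy) hx⟩
  have hz' := h.trans hz hx
  exact h.mem_trans (h.trans hyz hz') hz' hx hyz hz

/-- A set of ordinals has a least element. -/
theorem exists_least_mem {s : M} (hs : ∃ x, x ∈ₘ s) (h : ∀ x, x ∈ₘ s → IsOrd x) :
    ∃ m, m ∈ₘ s ∧ ∀ x, x ∈ₘ s → ¬ x ∈ₘ m := by
  obtain ⟨α, hα⟩ := hs
  by_cases hm : ∀ x, x ∈ₘ s → ¬ x ∈ₘ α
  · exact ⟨α, hα, hm⟩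
  push Not at hm
  obtain ⟨x, hxs, hxα⟩ := hm
  obtain ⟨t, ht⟩ := exists_sep (fun y => y ∈ₘ s) α
  obtain ⟨m, hm, hmin⟩ := (h α hα).2.2 t ⟨x, (ht x).2 ⟨hxα, hxs⟩⟩ fun y hy => ((ht y).1 hy).1
  refine ⟨m, ((ht m).1 hm).2, fun y hy hym => hmin y ((ht y).2 ⟨?_, hy⟩) hym⟩
  exact (h α hα).trans hym ((ht m).1 hm).1

/-- `β` is the least ordinal with the property `P`. -/
def Least (P : M → Prop) (β : M) : Prop := IsOrd β ∧ P β ∧ ∀ γ, γ ∈ₘ β → ¬ P γ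

instance DefP.least {L : Language} [L.Structure M] {A : Set M} [DefStr L M] {ι : Type}
    (P : (ι → M) → M → Prop) (t : (ι → M) → M) [DefT L A t] [DefP L A (fun v => P v (t v))]
    [DefP L A (fun w : ι ⊕ Fin 1 → M => P (w ∘ Sum.inl) (w (Sum.inr 0)))] :
    DefP L A (fun v => Least (P v) (t v)) := by
  unfold Least; infer_instance

theorem exists_least (P : M → Prop) (h : IsOrd α) (hα : P α)
    (hP : DefP LMemE univ (fun v : Fin 1 → M => P (v 0)) := by infer_instance) :
    ∃ β, Least P β := by
  by_cases hm : ∃ β, β ∈ₘ α ∧ P β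
  · obtain ⟨t, ht⟩ := exists_sep P α
    obtain ⟨m, hm, hmin⟩ := h.2.2 t (by simpa [ht] using hm) fun y hy => ((ht y).1 hy).1
    refine ⟨m, h.of_mem ((ht m).1 hm).1, ((ht m).1 hm).2, fun γ hγ hP => ?_⟩
    exact hmin γ ((ht γ).2 ⟨h.trans hγ ((ht m).1 hm).1, hP⟩) hγ
  · exact ⟨α, h, hα, fun β hβ hPβ => hm ⟨β, hβ, hPβ⟩⟩

/-- Transfinite induction for definable properties. -/
theorem IsOrd.induction (P : M → Prop) (h : IsOrd α)
    (ih : ∀ α, IsOrd α → (∀ β, β ∈ₘ α → P β) → P α)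
    (hP : DefP LMemE univ (fun v : Fin 1 → M => P (v 0)) := by infer_instance) : P α := by
  by_contra hα
  obtain ⟨β, hβ, hn, hmin⟩ := exists_least (fun x => ¬ P x) h hα
  exact hn (ih β hβ fun γ hγ => not_not.1 (hmin γ hγ))

/-- A transitive proper subset of an ordinal is one of its elements. -/
theorem IsOrd.mem_of_transitive (h : IsOrd α) (hx : ∀ y z, y ∈ₘ z → z ∈ₘ x → y ∈ₘ x)
    (hxα : ∀ y, y ∈ₘ x → y ∈ₘ α) (hne : x ≠ α) : x ∈ₘ α := by
  obtain ⟨t, ht⟩ := exists_sep (fun y => ¬ y ∈ₘ x) α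
  have : ∃ y, y ∈ₘ t := by
    by_contra hn
    push Not at hn
    exact hne (ext_iff'.2 fun z => ⟨hxα z, fun hz => by simpa [ht, hz] using hn z⟩)
  obtain ⟨m, hm, hmin⟩ := h.2.2 t this fun y hy => ((ht y).1 hy).1
  obtain ⟨hmα, hmx⟩ := (ht m).1 hm
  suffices x = m by rwa [this]
  refine ext_iff'.2 fun z => ⟨fun hz => ?_, fun hz => ?_⟩
  · rcases h.2.1 z m (hxα z hz) hmα with h1 | rfl | h1
    · exact h1
    · exact absurd hz hmx
    · exact absurd (hx m z h1 hz) hmx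
  · by_contra hzx
    exact hmin z ((ht z).2 ⟨h.trans hz hmα, hzx⟩) hz

theorem IsOrd.trichotomy (hα : IsOrd α) (hβ : IsOrd β) : α ∈ₘ β ∨ α = β ∨ β ∈ₘ α := by
  obtain ⟨γ, hγ⟩ := exists_sep (fun y => y ∈ₘ β) α
  have htr : ∀ y z, y ∈ₘ z → z ∈ₘ γ → y ∈ₘ γ := fun y z hyz hz =>
    (hγ y).2 ⟨hα.trans hyz ((hγ z).1 hz).1, hβ.trans hyz ((hγ z).1 hz).2⟩
  have h1 := hα.mem_of_transitive htr fun y hy => ((hγ y).1 hy).1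
  have h2 := hβ.mem_of_transitive htr fun y hy => ((hγ y).1 hy).2
  by_cases ha : γ = α
  · by_cases hb : γ = β
    · exact Or.inr (Or.inl (ha.symm.trans hb))
    · exact Or.inl (ha ▸ h2 hb)
  · by_cases hb : γ = β
    · exact Or.inr (Or.inr (hb ▸ h1 ha))
    · exact absurd ((hγ γ).2 ⟨h1 ha, h2 hb⟩) (hα.not_mem_self_of_mem (h1 ha))

theorem Least.unique {P : M → Prop} (h : Least P α) (h' : Least P β) : α = β := by
  rcases h.1.trichotomy h'.1 with h1 | h1 | h1
  · exact absurd h.2.1 (h'.2.2 _ h1)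
  · exact h1
  · exact absurd h'.2.1 (h.2.2 _ h1)

/-- A transitive set of ordinals is an ordinal. -/
theorem isOrd_of_transitive (hx : ∀ y z, y ∈ₘ z → z ∈ₘ x → y ∈ₘ x) (h : ∀ y, y ∈ₘ x → IsOrd y) :
    IsOrd x :=
  ⟨hx, fun y z hy hz => (h y hy).trichotomy (h z hz), fun _ hs hsx =>
    exists_least_mem hs fun y hy => h y (hsx y hy)⟩

/-- Every set of ordinals is strictly bounded. -/
theorem exists_bound (s : M) (h : ∀ x, x ∈ₘ s → IsOrd x) :
    ∃ γ, IsOrd γ ∧ ∀ x, x ∈ₘ s → x ∈ₘ γ := by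
  obtain ⟨b, hb⟩ := exists_sUnion s
  obtain ⟨γ, hγ⟩ := exists_union b s
  refine ⟨γ, isOrd_of_transitive (fun y z hyz hz => ?_) (fun y hy => ?_),
    fun x hx => (hγ x).2 (Or.inr hx)⟩
  · rcases (hγ z).1 hz with hz | hz
    · obtain ⟨w, hw, hzw⟩ := (hb z).1 hz
      exact (hγ y).2 (Or.inl ((hb y).2 ⟨w, hw, (h w hw).trans hyz hzw⟩))
    · exact (hγ y).2 (Or.inl ((hb y).2 ⟨z, hz, hyz⟩))
  · rcases (hγ y).1 hy with hy | hy
    · obtain ⟨w, hw, hyw⟩ := (hb y).1 hy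
      exact (h w hw).of_mem hyw
    · exact h y hy

theorem exists_bound₂ (hα : IsOrd α) (hβ : IsOrd β) : ∃ γ, IsOrd γ ∧ α ∈ₘ γ ∧ β ∈ₘ γ := by
  obtain ⟨γ, hγ, h⟩ := exists_bound (upair α β) (by simp [mem_upair, hα, hβ])
  exact ⟨γ, hγ, h _ (mem_upair.2 (Or.inl rfl)), h _ (mem_upair.2 (Or.inr rfl))⟩

/-- The ordinals beyond any given one do not form a set: the Burali-Forti paradox. -/
theorem exists_not_mem_of_isOrd (s : M) (hα : IsOrd α) :
    ∃ β, IsOrd β ∧ α ∈ₘ β ∧ ¬ β ∈ₘ s := by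
  obtain ⟨t, ht⟩ := exists_sep (fun x => IsOrd x) s
  obtain ⟨γ, hγ, hγs⟩ := exists_bound t fun x hx => ((ht x).1 hx).2
  obtain ⟨δ, hδ, h1, h2⟩ := exists_bound₂ hα hγ
  have := fun hs => hγs δ ((ht δ).2 ⟨hs, hδ⟩)
  exact ⟨δ, hδ, h1, fun hs => hγ.not_mem_self (hγ.trans h2 (this hs))⟩

end Ordinals

/-! ### Ranks and the segments of the universe -/

section Ranks

variable {M : Type*} [SetStr M] [hZF : Fact (IsModelZFWithoutRegularity M)]
  [hBF : Fact (IsBestFounded M)] {α β γ x y z u : M}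

/-- Two rank functions agree where both are defined: otherwise they would differ at some `E`-minimal
point. -/
theorem IsRankFun.agree {f g : M} (hf : IsRankFun f) (hg : IsRankFun g) (hx : App f x α)
    (hx' : App g x β) : α = β := by
  by_contra hne
  obtain ⟨d, hd⟩ := exists_image (fun p x : M => ∃ y, p = opair x y) f (by
    rintro p - x y ⟨x', rfl⟩ ⟨y', h⟩
    exact (opair_inj.1 h).1)
  obtain ⟨s, hs⟩ := exists_sep (fun x => ∃ α β, App f x α ∧ App g x β ∧ α ≠ β) d
  have hs' : ∀ x, x ∈ₘ s ↔ ∃ α β, App f x α ∧ App g x β ∧ α ≠ β := fun x => by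
    rw [hs, hd, and_iff_right_iff_imp]
    rintro ⟨α, β, h, -⟩
    exact ⟨_, app_iff.1 h, α, rfl⟩
  obtain ⟨m, hm, hmin⟩ := hBF.out.wellFounded s ⟨x, (hs' x).2 ⟨α, β, hx, hx', hne⟩⟩
  obtain ⟨α, β, hα, hβ, hne⟩ := (hs' m).1 hm
  refine hne (ext_iff'.2 fun ξ => ?_)
  rw [hf.2.2.2 m α hα, hg.2.2.2 m β hβ]
  refine exists_congr fun y => exists_congr fun δ => and_congr_right fun h1 =>
    and_congr_right fun h2 => and_congr_left fun _ => ?_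
  obtain ⟨δ₁, h3⟩ := hf.2.2.1 m α y hα h1
  obtain ⟨δ₂, h4⟩ := hg.2.2.1 m β y hβ h1
  have : δ₁ = δ₂ := by
    by_contra h5
    exact hmin y ((hs' y).2 ⟨_, _, h3, h4, h5⟩) h2 h1
  subst this
  exact ⟨fun h => hf.2.1 _ _ _ h h3 ▸ h4, fun h => hg.2.1 _ _ _ h h4 ▸ h3⟩

theorem HasRank.unique (h : HasRank x α) (h' : HasRank x β) : α = β := by
  obtain ⟨f, hf, hx⟩ := h
  obtain ⟨g, hg, hx'⟩ := h'
  exact hf.agree hg hx hx'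

omit hZF hBF in
theorem HasRank.isOrd (h : HasRank x α) : IsOrd α := by
  obtain ⟨f, hf, hx⟩ := h
  exact hf.1 x α hx

omit hZF hBF in
theorem HasRank.exists_of_mem (h : HasRank x α) (hγ : γ ∈ₘ α) :
    ∃ y β, y ≺ₑ x ∧ y ≠ x ∧ HasRank y β ∧ (γ ∈ₘ β ∨ γ = β) := by
  obtain ⟨f, hf, hx⟩ := h
  obtain ⟨y, β, h1, h2, h3, h4⟩ := (hf.2.2.2 x α hx γ).1 hγ
  exact ⟨y, β, h1, h2, ⟨f, hf, h3⟩, h4⟩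

theorem HasRank.mem_of_rel (h : HasRank x α) (hy : y ≺ₑ x) (hne : y ≠ x) (hβ : HasRank y β) :
    β ∈ₘ α := by
  obtain ⟨f, hf, hx⟩ := h
  obtain ⟨β', h'⟩ := hf.2.2.1 x α y hx hy
  obtain rfl := hβ.unique ⟨f, hf, h'⟩
  exact (hf.2.2.2 x α hx β).2 ⟨y, β, hy, hne, h', Or.inr rfl⟩

theorem exists_segment (hα : IsOrd α) : ∃ u, IsSegment α u :=
  exists_iUnion (fun β x => HasRank x β) α fun β hβ => hBF.out.level_isSet β (hα.of_mem hβ)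

/-- Every ordinal is a rank: otherwise the ranks would be bounded, and the universe a set. -/
theorem exists_hasRank (hα : IsOrd α) : ∃ x, HasRank x α := by
  by_contra hn
  push Not at hn
  obtain ⟨u, hu⟩ := exists_segment hα
  refine not_forall_mem u fun x => ?_
  obtain ⟨ρ, hρ⟩ := hBF.out.rank_exists x
  rw [hu]
  rcases hρ.isOrd.trichotomy hα with h | rfl | h
  · exact ⟨ρ, h, hρ⟩
  · exact absurd hρ (hn x)
  · obtain ⟨δ, hδ, ⟨hαδ, z, hz⟩, hmin⟩ :=
      exists_least (fun δ => α ∈ₘ δ ∧ ∃ x, HasRank x δ) hρ.isOrd ⟨h, x, hρ⟩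
    obtain ⟨y, β, h1, h2, h3, h4 | rfl⟩ := hz.exists_of_mem hαδ
    · exact absurd ⟨h4, y, h3⟩ (hmin β (hz.mem_of_rel h1 h2 h3))
    · exact absurd h3 (hn y)

omit hBF in
theorem IsSegment.unique (h : IsSegment α x) (h' : IsSegment α y) : x = y := ext_of h h'

/-- An ordinal can be recovered from its segment. -/
theorem IsSegment.ord_unique (hα : IsOrd α) (hβ : IsOrd β) (h : IsSegment α u)
    (h' : IsSegment β u) : α = β := by
  have key : ∀ {α β : M}, IsOrd α → IsSegment α u → IsSegment β u → ∀ ξ, ξ ∈ₘ α → ξ ∈ₘ β := by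
    intro α β hα h h' ξ hξ
    obtain ⟨x, hx⟩ := exists_hasRank (hα.of_mem hξ)
    obtain ⟨η, hη, hxη⟩ := (h' x).1 ((h x).2 ⟨ξ, hξ, hx⟩)
    exact hx.unique hxη ▸ hη
  exact ext_iff'.2 fun ξ => ⟨key hα h h' ξ, key hβ h' h ξ⟩

omit hZF hBF in
theorem IsSegment.mono {v : M} (hβ : IsOrd β) (hαβ : α ∈ₘ β) (h : IsSegment α u)
    (h' : IsSegment β v) (hx : x ∈ₘ u) : x ∈ₘ v := by
  obtain ⟨ξ, hξ, hxξ⟩ := (h x).1 hx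
  exact (h' x).2 ⟨ξ, hβ.trans hξ hαβ, hxξ⟩

/-- Collection: witnesses for the members of a set are found in some segment. -/
theorem exists_collection (R : M → M → Prop) (a : M)
    (h : DefP LMemE univ (fun v : Fin 2 → M => R (v 0) (v 1)) := by infer_instance) :
    ∃ γ, IsOrd γ ∧ ∀ x, x ∈ₘ a → (∃ y, R x y) → ∃ y ρ, ρ ∈ₘ γ ∧ HasRank y ρ ∧ R x y := by
  have h' {ι : Type} (t s : (ι → M) → M) [DefT LMemE univ t] [DefT LMemE univ s] :
    DefP LMemE univ (fun v => R (t v) (s v)) := DefP.subst₂ h t s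
  obtain ⟨b, hb⟩ := exists_image (fun x ρ => Least (fun ρ => ∃ y, HasRank y ρ ∧ R x y) ρ) a
    (fun x _ ρ σ h h' => h.unique h')
  obtain ⟨γ, hγ, hbγ⟩ := exists_bound b fun ρ hρ => by
    obtain ⟨x, -, h⟩ := (hb ρ).1 hρ
    exact h.1
  refine ⟨γ, hγ, fun x hx ⟨y, hy⟩ => ?_⟩
  obtain ⟨ρ, hρ⟩ := hBF.out.rank_exists y
  obtain ⟨σ, hσ⟩ := exists_least (fun ρ => ∃ y, HasRank y ρ ∧ R x y) hρ.isOrd ⟨y, hρ, hy⟩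
  obtain ⟨z, hz, hxz⟩ := hσ.2.1
  exact ⟨z, σ, hbγ σ ((hb σ).2 ⟨x, hx, hσ⟩), hz, hxz⟩

theorem exists_subset_segment (a : M) :
    ∃ γ u, IsOrd γ ∧ IsSegment γ u ∧ ∀ x, x ∈ₘ a → x ∈ₘ u := by
  obtain ⟨γ, hγ, h⟩ := exists_collection (fun x y => y = x) a
  obtain ⟨u, hu⟩ := exists_segment hγ
  refine ⟨γ, u, hγ, hu, fun x hx => ?_⟩
  obtain ⟨_, ρ, hρ, hx', rfl⟩ := h x hx ⟨x, rfl⟩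
  exact (hu _).2 ⟨ρ, hρ, hx'⟩

end Ranks

/-! ### Classes closed under the Gödel operations -/

section Closure

variable {M : Type*} [SetStr M] [hZF : Fact (IsModelZFWithoutRegularity M)] {C : Set M}

omit [SetStr M] hZF in
theorem ClosedUnder.of_exists {ops : Set (M → M → M → Prop)} {G : M → M → M → Prop}
    (hC : ClosedUnder ops C) (hG : G ∈ ops) {X Y : M} (hX : X ∈ C) (hY : Y ∈ C)
    (h : ∃ Z, G X Y Z) : ∃ Z ∈ C, G X Y Z := by
  obtain ⟨Z, hZ⟩ := h
  exact ⟨Z, hC G hG X Y Z hX hY hZ, hZ⟩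

variable (hC : ClosedUnder (godelOps M) C) {X Y : M} (hX : X ∈ C) (hY : Y ∈ C)
include hC hX

theorem ClosedUnder.singleton : ∃ Z ∈ C, ∀ w, w ∈ₘ Z ↔ w = X := by
  obtain ⟨Z, hZ, h⟩ := hC.of_exists (G := GPair) (by simp [godelOps]) hX hX
    ⟨upair X X, fun w => mem_upair⟩
  exact ⟨Z, hZ, by simpa [GPair, IsPair] using h⟩

theorem ClosedUnder.dom : ∃ Z ∈ C, ∀ u, u ∈ₘ Z ↔ ∃ v, opair u v ∈ₘ X := by
  obtain ⟨b, hb⟩ := exists_image (fun p u => ∃ v, p = opair u v) X (by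
    rintro p - x y ⟨x', rfl⟩ ⟨y', h⟩
    exact (opair_inj.1 h).1)
  have := hC.of_exists (G := GDom) (by simp [godelOps]) hX hX
  simp only [GDom, app_iff] at this
  exact this ⟨b, fun u => by rw [hb]; grind⟩

theorem ClosedUnder.swap : ∃ Z ∈ C, ∀ p, p ∈ₘ Z ↔ ∃ u v, opair v u ∈ₘ X ∧ p = opair u v := by
  obtain ⟨b, hb⟩ := exists_image (fun q p => ∃ u v, q = opair v u ∧ p = opair u v) X (by
    rintro p - x y ⟨u, v, rfl, rfl⟩ ⟨u', v', h, rfl⟩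
    simpa [opair_inj, and_comm] using h)
  have := hC.of_exists (G := GSwap) (by simp [godelOps]) hX hX
  simp only [GSwap, app_iff, isOPair_iff] at this
  exact this ⟨b, fun p => by rw [hb]; grind⟩

theorem ClosedUnder.transp : ∃ Z ∈ C, ∀ p, p ∈ₘ Z ↔
    ∃ u v w, opair (opair u w) v ∈ₘ X ∧ p = opair (opair u v) w := by
  obtain ⟨b, hb⟩ := exists_image (fun q p => ∃ u v w, q = opair (opair u w) v ∧
    p = opair (opair u v) w) X (by
    rintro p - x y ⟨u, v, w, rfl, rfl⟩ ⟨u', v', w', h, rfl⟩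
    simp only [opair_inj] at h ⊢
    tauto)
  have := hC.of_exists (G := GTransp) (by simp [godelOps]) hX hX
  simp only [GTransp, isTriple_iff] at this
  obtain ⟨Z, hZ, h⟩ := this ⟨b, fun p => by rw [hb]; grind⟩
  exact ⟨Z, hZ, fun p => by rw [h]; grind⟩

theorem ClosedUnder.cycle : ∃ Z ∈ C, ∀ p, p ∈ₘ Z ↔
    ∃ u v w, opair (opair v w) u ∈ₘ X ∧ p = opair (opair u v) w := by
  obtain ⟨b, hb⟩ := exists_image (fun q p => ∃ u v w, q = opair (opair v w) u ∧
    p = opair (opair u v) w) X (by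
    rintro p - x y ⟨u, v, w, rfl, rfl⟩ ⟨u', v', w', h, rfl⟩
    simp only [opair_inj] at h ⊢
    tauto)
  have := hC.of_exists (G := GCycle) (by simp [godelOps]) hX hX
  simp only [GCycle, isTriple_iff] at this
  obtain ⟨Z, hZ, h⟩ := this ⟨b, fun p => by rw [hb]; grind⟩
  exact ⟨Z, hZ, fun p => by rw [h]; grind⟩

include hY

theorem ClosedUnder.prod :
    ∃ Z ∈ C, ∀ p, p ∈ₘ Z ↔ ∃ u v, u ∈ₘ X ∧ v ∈ₘ Y ∧ p = opair u v := by
  obtain ⟨b, hb⟩ := exists_subset_prod (fun _ => True) X Y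
  have : GProd (M := M) ∈ godelOps M := by simp [godelOps]
  simpa only [GProd, isOPair_iff] using
    hC.of_exists this hX hY ⟨b, by simpa [GProd, isOPair_iff] using hb⟩

theorem ClosedUnder.diff : ∃ Z ∈ C, ∀ u, u ∈ₘ Z ↔ u ∈ₘ X ∧ ¬ u ∈ₘ Y := by
  exact hC.of_exists (G := GDiff) (by simp [godelOps]) hX hY (exists_sep (fun u => ¬ u ∈ₘ Y) X)

theorem ClosedUnder.inter : ∃ Z ∈ C, ∀ u, u ∈ₘ Z ↔ u ∈ₘ X ∧ u ∈ₘ Y := by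
  exact hC.of_exists (G := GInter) (by simp [godelOps]) hX hY (exists_sep (fun u => u ∈ₘ Y) X)

end Closure

/-! ### The sets defined by formulas inside a segment -/

section NormalForm

variable {M : Type*} [SetStr M] [hZF : Fact (IsModelZFWithoutRegularity M)]

/-- The tuple `(…((∅, x₀), x₁)…, xₙ₋₁)` coded as an element of `M`. -/
noncomputable def tup : {n : ℕ} → (Fin n → M) → M
  | 0, _ => emp M
  | n + 1, x => opair (tup (Fin.init x)) (x (Fin.last n))

theorem tup_snoc {n : ℕ} (x : Fin n → M) (a : M) :
    tup (Fin.snoc x a : Fin (n + 1) → M) = opair (tup x) a := by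
  simp [tup]

theorem tup_inj {n : ℕ} {x y : Fin n → M} : tup x = tup y ↔ x = y := by
  refine ⟨fun h => ?_, by rintro rfl; rfl⟩
  induction n with
  | zero => exact Subsingleton.elim _ _
  | succ n ih =>
    obtain ⟨h1, h2⟩ := opair_inj.1 h
    rw [← Fin.snoc_init_self x, ← Fin.snoc_init_self y, ih h1, h2]

omit [SetStr M] hZF in
theorem exists_snoc_iff {n : ℕ} {P : (Fin (n + 1) → M) → Prop} :
    (∃ x, P x) ↔ ∃ t a, P (Fin.snoc t a) :=
  ⟨fun ⟨x, hx⟩ => ⟨Fin.init x, x (Fin.last n), by rwa [Fin.snoc_init_self]⟩,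
    fun ⟨_, _, h⟩ => ⟨_, h⟩⟩

omit hZF in
theorem forall_snoc_mem_iff {n : ℕ} {t : Fin n → M} {a u : M} :
    (∀ i, (Fin.snoc t a : Fin (n + 1) → M) i ∈ₘ u) ↔ (∀ i, t i ∈ₘ u) ∧ a ∈ₘ u := by
  simp [Fin.forall_fin_succ']

theorem DefT.tup {ι : Type} {n : ℕ} (f : Fin n → ι) :
    DefT LMemE univ (fun v : ι → M => tup (fun i => v (f i))) := by
  induction n with
  | zero => exact DefT.const_univ (emp M)
  | succ n ih =>
    have := ih (fun i => f i.castSucc)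
    exact DefT.opair (fun v : ι → M => SetStr.tup (fun i : Fin n => v (f i.castSucc)))
      (fun v => v (f (Fin.last n)))

/-- The relation `R` is definable, and its restriction to every segment, coded as a set of tuples,
belongs to the class `C`. -/
structure Local (C : Set M) {n : ℕ} (R : (Fin n → M) → Prop) : Prop where
  defP : DefP LMemE univ R
  mem : ∀ β u, IsOrd β → IsSegment β u →
    ∃ Z ∈ C, ∀ p, p ∈ₘ Z ↔ ∃ x : Fin n → M, (∀ i, x i ∈ₘ u) ∧ R x ∧ p = tup x

variable {C : Set M} (hS : Segments M ⊆ C) (hC : ClosedUnder (godelOps M) C) {n : ℕ}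
include hS hC

theorem Local.init {R : (Fin n → M) → Prop} (h : Local C R) :
    Local C (fun x : Fin (n + 1) → M => R (Fin.init x)) where
  defP := by
    have := h.defP
    have : Restr (fun x : Fin (n + 1) → M => (Fin.init x : Fin n → M)) :=
      ⟨Fin.castSucc, fun _ _ => rfl⟩
    exact DefP.restr R _
  mem β u hβ hu := by
    obtain ⟨Z, hZ, h⟩ := h.mem β u hβ hu
    obtain ⟨W, hW, h'⟩ := hC.prod hZ (hS ⟨β, hβ, hu⟩)
    refine ⟨W, hW, fun p => ?_⟩
    simp only [h', h, exists_snoc_iff, Fin.init_snoc, tup_snoc, forall_snoc_mem_iff]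
    grind

variable (n) in
theorem Local.top : Local C (fun _ : Fin n → M => True) := by
  induction n with
  | zero =>
    refine ⟨inferInstance, fun β u hβ hu => ?_⟩
    have huC : u ∈ C := hS ⟨β, hβ, hu⟩
    obtain ⟨e, he, h⟩ := hC.diff huC huC
    obtain rfl : e = emp M := ext_iff'.2 fun z => by simp [h, not_mem_emp]
    obtain ⟨Z, hZ, h⟩ := hC.singleton he
    exact ⟨Z, hZ, fun p => by simp [h, tup]⟩
  | succ n ih => exact Local.init hS hC ih

omit hS

theorem Local.and {R S : (Fin n → M) → Prop} (hR : Local C R) (hS : Local C S) :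
    Local C (fun x => R x ∧ S x) where
  defP := by
    have := hR.defP
    have := hS.defP
    infer_instance
  mem β u hβ hu := by
    obtain ⟨Z, hZ, h⟩ := hR.mem β u hβ hu
    obtain ⟨W, hW, h'⟩ := hS.mem β u hβ hu
    obtain ⟨I, hI, h''⟩ := hC.inter hZ hW
    refine ⟨I, hI, fun p => ?_⟩
    rw [h'', h, h']
    constructor
    · rintro ⟨⟨x, hx, hxR, rfl⟩, ⟨y, -, hyS, hxy⟩⟩
      exact ⟨x, hx, ⟨hxR, tup_inj.1 hxy ▸ hyS⟩, rfl⟩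
    · rintro ⟨x, hx, ⟨hxR, hxS⟩, rfl⟩
      exact ⟨⟨x, hx, hxR, rfl⟩, ⟨x, hx, hxS, rfl⟩⟩

include hS

theorem Local.not {R : (Fin n → M) → Prop} (hR : Local C R) : Local C (fun x => ¬ R x) where
  defP := by
    have := hR.defP
    infer_instance
  mem β u hβ hu := by
    obtain ⟨Z, hZ, h⟩ := hR.mem β u hβ hu
    obtain ⟨W, hW, h'⟩ := (Local.top hS hC n).mem β u hβ hu
    obtain ⟨I, hI, h''⟩ := hC.diff hW hZ
    refine ⟨I, hI, fun p => ?_⟩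
    rw [h'', h, h']
    constructor
    · rintro ⟨⟨x, hx, -, rfl⟩, h⟩
      exact ⟨x, hx, fun hR => h ⟨x, hx, hR, rfl⟩, rfl⟩
    · rintro ⟨x, hx, hR, rfl⟩
      refine ⟨⟨x, hx, trivial, rfl⟩, ?_⟩
      rintro ⟨y, -, hyR, hxy⟩
      exact hR (tup_inj.1 hxy ▸ hyR)

theorem Local.imp {R S : (Fin n → M) → Prop} (h : Local C R) (h' : Local C S) :
    Local C (fun x => R x → S x) := by
  simpa using Local.not hS hC (Local.and hC h (Local.not hS hC h'))

/-- A binary relation that is definable, and whose restriction to every segment, as a set of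
ordered pairs, belongs to the class `C`. -/
structure Local₂ (C : Set M) (ρ : M → M → Prop) : Prop where
  defP : DefP LMemE univ (fun v : Fin 2 → M => ρ (v 0) (v 1))
  mem : ∀ β u, IsOrd β → IsSegment β u →
    ∃ Z ∈ C, ∀ p, p ∈ₘ Z ↔ ∃ a b, a ∈ₘ u ∧ b ∈ₘ u ∧ ρ a b ∧ p = opair a b

omit hS in
theorem Local₂.flip {ρ : M → M → Prop} (h : Local₂ C ρ) : Local₂ C (fun a b => ρ b a) where
  defP := DefP.subst₂ h.defP (fun v : Fin 2 → M => v 1) (fun v => v 0)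
  mem β u hβ hu := by
    obtain ⟨Z, hZ, h⟩ := h.mem β u hβ hu
    obtain ⟨W, hW, h'⟩ := hC.swap hZ
    refine ⟨W, hW, fun p => ?_⟩
    simp only [h', h, opair_inj]
    grind

/-- The last two variables are handled by an instance of associativity, `(t, (a, b))` becoming
`((t, a), b)`. -/
theorem Local₂.last_two {ρ : M → M → Prop} (h : Local₂ C ρ) :
    Local C (fun x : Fin (n + 2) → M => ρ (x (Fin.last n).castSucc) (x (Fin.last (n + 1)))) where
  defP := DefP.subst₂ h.defP _ _
  mem β u hβ hu := by
    obtain ⟨Z, hZ, h⟩ := h.mem β u hβ hu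
    obtain ⟨T, hT, hTp⟩ := (Local.top hS hC n).mem β u hβ hu
    obtain ⟨P, hP, hPp⟩ := hC.prod hZ hT
    obtain ⟨W, hW, hWp⟩ := hC.cycle hP
    refine ⟨W, hW, fun p => ?_⟩
    simp only [hWp, hPp, hTp, h, exists_snoc_iff, forall_snoc_mem_iff, tup_snoc, Fin.snoc_last,
      Fin.snoc_castSucc]
    constructor
    · rintro ⟨t, a, b, ⟨_, _, ⟨a', b', ha, hb, hab, rfl⟩, ⟨x, hx, -, rfl⟩, h⟩, rfl⟩
      obtain ⟨h', rfl⟩ := opair_inj.1 h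
      obtain ⟨rfl, rfl⟩ := opair_inj.1 h'
      exact ⟨x, a, b, ⟨⟨hx, ha⟩, hb⟩, hab, rfl⟩
    · rintro ⟨x, a, b, ⟨⟨hx, ha⟩, hb⟩, hab, rfl⟩
      exact ⟨tup x, a, b, ⟨_, _, ⟨a, b, ha, hb, hab, rfl⟩, ⟨x, hx, trivial, rfl⟩, rfl⟩, rfl⟩

omit hS in
theorem Local.swap_last {R S : (Fin (n + 2) → M) → Prop} (h : Local C R) (hS : DefP LMemE univ S)
    (hRS : ∀ t a b, S (Fin.snoc (Fin.snoc t a : Fin (n + 1) → M) b) ↔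
      R (Fin.snoc (Fin.snoc t b : Fin (n + 1) → M) a)) : Local C S where
  defP := hS
  mem β u hβ hu := by
    obtain ⟨Z, hZ, h⟩ := h.mem β u hβ hu
    obtain ⟨W, hW, h'⟩ := hC.transp hZ
    refine ⟨W, hW, fun p => ?_⟩
    simp only [h', h, exists_snoc_iff, forall_snoc_mem_iff, tup_snoc, opair_inj, hRS]
    grind

/-- The last variable and any other one: the other one is brought to the last place but one by
exchanges of the last two variables. -/
theorem Local₂.last {ρ : M → M → Prop} (h : Local₂ C ρ) (i : Fin n) :
    Local C (fun x : Fin (n + 1) → M => ρ (x i.castSucc) (x (Fin.last n))) := by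
  induction n with
  | zero => exact i.elim0
  | succ n ih =>
    induction i using Fin.lastCases with
    | last => exact Local₂.last_two hS hC h
    | cast i =>
      refine Local.swap_last hC (Local.init hS hC (ih i)) (DefP.subst₂ h.defP _ _) fun t a b => ?_
      simp

theorem Local₂.of_ne {ρ : M → M → Prop} (h : Local₂ C ρ) {i j : Fin n} (hij : i ≠ j) :
    Local C (fun x : Fin n → M => ρ (x i) (x j)) := by
  induction n with
  | zero => exact i.elim0
  | succ n ih =>
    induction i using Fin.lastCases with
    | last =>
      induction j using Fin.lastCases with
      | last => exact absurd rfl hij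
      | cast j => exact Local₂.last hS hC (Local₂.flip hC h) j
    | cast i =>
      induction j using Fin.lastCases with
      | last => exact Local₂.last hS hC h i
      | cast j => exact Local.init hS hC (ih (i := i) (j := j) (by simpa using hij))

theorem Local₂.mem_rel : Local₂ C (fun a b => a ∈ₘ b) where
  defP := inferInstance
  mem β u hβ hu := by
    have huC : u ∈ C := hS ⟨β, hβ, hu⟩
    obtain ⟨b, hb⟩ := exists_subset_prod (fun p => ∃ x y, x ∈ₘ y ∧ p = opair x y) u u
    have hG : GMem (M := M) ∈ godelOps M := by simp [godelOps]
    simpa only [GMem, isOPair_iff] using hC.of_exists hG huC huC ⟨b, fun p => by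
      rw [hb]
      simp only [isOPair_iff]
      grind [opair_inj]⟩

omit hC in
theorem Local₂.rel_rel (hC : ClosedUnder (godelOpsE M) C) : Local₂ C (fun a b => a ≺ₑ b) where
  defP := inferInstance
  mem β u hβ hu := by
    have huC : u ∈ C := hS ⟨β, hβ, hu⟩
    obtain ⟨b, hb⟩ := exists_subset_prod (fun p => ∃ x y, x ≺ₑ y ∧ p = opair x y) u u
    have hG : GRel (M := M) ∈ godelOpsE M := by simp [godelOpsE]
    simpa only [GRel, isOPair_iff] using hC.of_exists hG huC huC ⟨b, fun p => by
      rw [hb]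
      simp only [isOPair_iff]
      grind [opair_inj]⟩

theorem Local₂.eq_const {c : M} (hc : c ∈ C) : Local₂ C (fun a _ => a = c) where
  defP := inferInstance
  mem β u hβ hu := by
    have huC : u ∈ C := hS ⟨β, hβ, hu⟩
    obtain ⟨s, hs, hsp⟩ := hC.singleton hc
    obtain ⟨I, hI, hIp⟩ := hC.inter huC hs
    obtain ⟨P, hP, hPp⟩ := hC.prod hI huC
    refine ⟨P, hP, fun p => ?_⟩
    rw [hPp]
    grind

variable [hBF : Fact (IsBestFounded M)]

/-- The existential quantifier. By Collection, one segment contains witnesses for all tuples from a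
given segment, so that the quantifier becomes the domain of a set in `C`. -/
theorem Local.ex {R : (Fin n → M) → Prop} {S : (Fin (n + 1) → M) → Prop} (h : Local C S)
    (hRS : ∀ x, R x ↔ ∃ y, S (Fin.snoc x y)) : Local C R where
  defP := by
    have := h.defP
    have : Restr (fun w : Fin n ⊕ Fin 1 → M =>
        (Fin.snoc (w ∘ Sum.inl) (w (Sum.inr 0)) : Fin (n + 1) → M)) := by
      refine ⟨Fin.snoc Sum.inl (Sum.inr 0), fun v i => ?_⟩
      induction i using Fin.lastCases <;> simp
    have : DefP LMemE univ (fun w : Fin n ⊕ Fin 1 → M =>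
        S (Fin.snoc (w ∘ Sum.inl) (w (Sum.inr 0)))) := DefP.restr S _
    obtain rfl : R = fun x => ∃ y, S (Fin.snoc x y) := funext fun x => propext (hRS x)
    infer_instance
  mem β u hβ hu := by
    have hdef : DefP LMemE univ (fun v : Fin 2 → M =>
        ∃ x : Fin n → M, v 0 = tup x ∧ S (Fin.snoc x (v 1))) := by
      refine DefP.exists_tuple _ ?_
      have := h.defP
      have : Restr (fun w : Fin 2 ⊕ Fin n → M =>
          (Fin.snoc (w ∘ Sum.inr) ((w ∘ Sum.inl) 1) : Fin (n + 1) → M)) := by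
        refine ⟨Fin.snoc Sum.inr (Sum.inl 1), fun v i => ?_⟩
        induction i using Fin.lastCases <;> simp
      have h1 : DefP LMemE univ (fun w : Fin 2 ⊕ Fin n → M =>
        S (Fin.snoc (w ∘ Sum.inr) ((w ∘ Sum.inl) 1))) := DefP.restr S _
      have h2 := DefT.tup (M := M) (Sum.inr : Fin n → Fin 2 ⊕ Fin n)
      have h3 : DefT LMemE univ (fun w : Fin 2 ⊕ Fin n → M => (w ∘ Sum.inl) 0) :=
        DefT.var (fun w => w) (Sum.inl 0)
      exact @DefP.and _ _ _ _ _ _ _ (@DefP.eq _ _ _ _ _ _ _ h3 h2) h1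
    obtain ⟨T, hT, hTp⟩ := (Local.top hS hC n).mem β u hβ hu
    obtain ⟨δ, hδ, hδT⟩ := exists_collection
      (fun p y => ∃ x : Fin n → M, p = tup x ∧ S (Fin.snoc x y)) T hdef
    obtain ⟨γ, hγ, hβγ, hδγ⟩ := exists_bound₂ hβ hδ
    obtain ⟨w, hw⟩ := exists_segment hγ
    obtain ⟨Z, hZ, hZp⟩ := h.mem γ w hγ hw
    obtain ⟨D, hD, hDp⟩ := hC.dom hZ
    obtain ⟨I, hI, hIp⟩ := hC.inter hT hD
    refine ⟨I, hI, fun p => ?_⟩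
    rw [hIp, hTp, hDp]
    constructor
    · rintro ⟨⟨x, hx, -, rfl⟩, y, hy⟩
      obtain ⟨x', -, hx', h⟩ := (hZp _).1 hy
      rw [← tup_snoc, tup_inj] at h
      exact ⟨x, hx, (hRS x).2 ⟨y, h ▸ hx'⟩, rfl⟩
    · rintro ⟨x, hx, hR, rfl⟩
      refine ⟨⟨x, hx, trivial, rfl⟩, ?_⟩
      obtain ⟨y, hy⟩ := (hRS x).1 hR
      obtain ⟨y, ρ, hρ, hyρ, x', hxx', hS⟩ :=
        hδT (tup x) ((hTp _).2 ⟨x, hx, trivial, rfl⟩) ⟨y, x, rfl, hy⟩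
      obtain rfl := tup_inj.1 hxx'
      refine ⟨y, (hZp _).2 ⟨Fin.snoc x y, ?_, hS, (tup_snoc x y).symm⟩⟩
      exact forall_snoc_mem_iff.2
        ⟨fun i => hu.mono hγ hβγ hw (hx i), (hw y).2 ⟨ρ, hγ.trans hρ hδγ, hyρ⟩⟩

theorem Local.all {R : (Fin n → M) → Prop} {S : (Fin (n + 1) → M) → Prop} (h : Local C S)
    (hRS : ∀ x, R x ↔ ∀ y, S (Fin.snoc x y)) : Local C R := by
  have : Local C (fun x => ¬ R x) := Local.ex hS hC (Local.not hS hC h) (by simp [hRS])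
  simpa using Local.not hS hC this

/-- Equality is reduced to membership by Extensionality. -/
theorem Local.eq (i j : Fin n) : Local C (fun x : Fin n → M => x i = x j) := by
  by_cases hij : i = j
  · subst hij
    simpa using Local.top hS hC n
  · have h (k : Fin n) := Local₂.of_ne hS hC (Local₂.mem_rel hS hC) (Fin.castSucc_ne_last k).symm
    refine Local.all hS hC (Local.and hC (Local.imp hS hC (h i) (h j))
      (Local.imp hS hC (h j) (h i))) fun x => ?_
    simp [ext_iff', iff_def]

theorem Local.eq_const {c : M} (hc : c ∈ C) (i : Fin n) :
    Local C (fun x : Fin n → M => x i = c) :=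
  Local.ex hS hC (Local₂.of_ne hS hC (Local₂.eq_const hS hC hc) (Fin.castSucc_ne_last i))
    fun x => by simpa using fun _ => ⟨c⟩

theorem Local₂.var {ρ : M → M → Prop} (h : Local₂ C ρ) (i j : Fin n) :
    Local C (fun x : Fin n → M => ρ (x i) (x j)) := by
  by_cases hij : i = j
  · subst hij
    refine Local.ex hS hC (Local.and hC (Local.eq hS hC (Fin.last n) i.castSucc)
      (Local₂.of_ne hS hC h (Fin.castSucc_ne_last i))) fun x => ?_
    simp
  · exact Local₂.of_ne hS hC h hij

omit hC hS hZF hBF in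
/-- The values of a term of a relational language: a variable, or a parameter in `C`. -/
def IsTermFun (C : Set M) {n : ℕ} (s : (Fin n → M) → M) : Prop :=
  (∃ i, ∀ x, s x = x i) ∨ ∃ c ∈ C, ∀ x, s x = c

theorem Local.eq_term {s : (Fin n → M) → M} (hs : IsTermFun C s) :
    Local C (fun x : Fin (n + 1) → M => x (Fin.last n) = s (Fin.init x)) := by
  rcases hs with ⟨i, hi⟩ | ⟨c, hc, h⟩
  · simp only [hi]
    exact Local.eq hS hC (Fin.last n) i.castSucc
  · simp only [h]
    exact Local.eq_const hS hC hc _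

/-- Terms may be substituted into relations, by means of the existential quantifier. -/
theorem Local.term {ρ : M → M → Prop}
    (h : ∀ (n : ℕ) (i j : Fin n), Local C (fun x : Fin n → M => ρ (x i) (x j)))
    {s t : (Fin n → M) → M} (hs : IsTermFun C s) (ht : IsTermFun C t) :
    Local C (fun x => ρ (s x) (t x)) := by
  have ht' : IsTermFun C (fun x : Fin (n + 1) → M => t (Fin.init x)) := by
    rcases ht with ⟨i, hi⟩ | ⟨c, hc, h⟩
    · exact Or.inl ⟨i.castSucc, fun x => hi _⟩
    · exact Or.inr ⟨c, hc, fun x => h _⟩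
  have h1 : Local C (fun x : Fin (n + 1) → M => ρ (x (Fin.last n)) (t (Fin.init x))) :=
    Local.ex hS hC (Local.and hC (Local.eq_term hS hC ht')
      (h _ (Fin.last n).castSucc (Fin.last (n + 1)))) fun x => by simp
  exact Local.ex hS hC (Local.and hC (Local.eq_term hS hC hs) h1) fun x => by simp

variable {L : Language} [L.Structure M] [L.IsRelational]

/-- Every relation symbol of `L` stands for a binary relation between two of its arguments, and the
restrictions of this relation to the segments belong to `C`. -/
def LocalSymbols (L : Language) [L.Structure M] (C : Set M) : Prop :=
  ∀ (k : ℕ) (R : L.Relations k), ∃ (ρ : M → M → Prop) (i j : Fin k),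
    (∀ v : Fin k → M, Language.Structure.RelMap R v ↔ ρ (v i) (v j)) ∧ Local₂ C ρ

/-- By induction on the formula, all definable relations with parameters from `C` are local. -/
theorem Local.formula (hL : LocalSymbols L C) {γ : Type*} {v : γ → M} (hv : ∀ a, v a ∈ C)
    (φ : L.BoundedFormula γ n) : Local C (fun x => φ.Realize v x) := by
  have ht {n : ℕ} (t : L.Term (γ ⊕ Fin n)) :
      IsTermFun C (fun x : Fin n → M => t.realize (Sum.elim v x)) := by
    rcases t with (a | i) | ⟨f, -⟩
    · exact Or.inr ⟨v a, hv a, fun _ => rfl⟩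
    · exact Or.inl ⟨i, fun _ => rfl⟩
    · exact isEmptyElim f
  induction φ with
  | @falsum n => simpa [Language.BoundedFormula.Realize] using Local.not hS hC (Local.top hS hC n)
  | equal t s => exact Local.term hS hC (fun n i j => Local.eq hS hC i j) (ht t) (ht s)
  | rel R ts =>
    obtain ⟨ρ, i, j, hR, hρ⟩ := hL _ R
    have := Local.term hS hC (fun n i j => Local₂.var hS hC hρ i j) (ht (ts i)) (ht (ts j))
    simpa only [Language.BoundedFormula.Realize, hR] using this
  | imp φ ψ ih1 ih2 => exact Local.imp hS hC ih1 ih2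
  | all φ ih => exact Local.all hS hC ih fun x => Iff.rfl

/-- A set defined by an `L`-formula with parameters from `C` belongs to `C`. -/
theorem mem_of_definable (hL : LocalSymbols L C) {A : Set M} (hA : A ⊆ C) {a : M}
    (ha : A.Definable₁ L {u | u ∈ₘ a}) : a ∈ C := by
  obtain ⟨φ, hφ⟩ := definable_iff_exists_formula_sum.1 ha
  have h := Local.formula hS hC hL (v := ((↑) : A → M)) (fun a => hA a.2)
    (Language.BoundedFormula.relabel (n := 1) id φ)
  have h : Local C (fun x : Fin 1 → M => x 0 ∈ₘ a) := by
    convert! h using 2 with x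
    have := Set.ext_iff.1 hφ x
    simp only [mem_ofPred_eq] at this
    rw [this, Language.BoundedFormula.realize_relabel, Language.Formula.Realize]
    congr!
  obtain ⟨γ, u, hγ, hu, hau⟩ := exists_subset_segment a
  -- `Z` consists of the pairs `(∅, y)` with `y ∈ a`.
  obtain ⟨Z, hZ, hZp⟩ := h.mem γ u hγ hu
  obtain ⟨W, hW, hWp⟩ := hC.swap hZ
  obtain ⟨D, hD, hDp⟩ := hC.dom hW
  suffices D = a from this ▸ hD
  refine ext_iff'.2 fun y => ?_
  rw [hDp]
  constructor
  · rintro ⟨z, hz⟩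
    obtain ⟨_, _, h1, h2⟩ := (hWp _).1 hz
    obtain ⟨rfl, rfl⟩ := opair_inj.1 h2
    obtain ⟨x, -, hx, h3⟩ := (hZp _).1 h1
    exact (opair_inj.1 h3).2 ▸ hx
  · intro hy
    exact ⟨emp M, (hWp _).2 ⟨y, emp M, (hZp _).2 ⟨fun _ => y, fun _ => hau y hy, hy, rfl⟩, rfl⟩⟩

/-- The ordinals belong to every closed class that includes the segments, since an ordinal is
definable from its segment. -/
theorem ords_subset [DefStr L M] (hL : LocalSymbols L C) : Ords M ⊆ C := by
  intro α hα
  obtain ⟨u, hu⟩ := exists_segment hα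
  refine mem_of_definable hS hC hL (A := {u}) (by simpa using hS ⟨α, hα, hu⟩) ?_
  have : DefT L {u} (fun _ : Fin 1 → M => u) := DefT.const (mem_singleton u)
  have h : DefP L {u} (fun v : Fin 1 → M => ∃ β, IsOrd β ∧ IsSegment β u ∧ v 0 ∈ₘ β) :=
    @DefP.ex _ _ _ _ _ _ (@DefP.and _ _ _ _ _ _ _ inferInstance
      (@DefP.and _ _ _ _ _ _ _ (@DefP.isSegment _ _ _ _ _ _ _ _ _ inferInstance
      (DefT.const (mem_singleton u))) inferInstance))
  unfold Definable₁
  convert! h.out using 1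
  ext v
  refine ⟨fun h => ⟨α, hα, hu, h⟩, ?_⟩
  rintro ⟨β, hβ, hβu, h⟩
  exact hu.ord_unique hα hβ hβu ▸ h

end NormalForm

/-! ### A definable recursion enumerating a closed class -/

section Enumeration

variable {M : Type*} [SetStr M]

/-- `z` is the first of the values given by the list `l` of (single-valued) predicates that has the
property `N`. -/
def FirstNew (N : M → Prop) : List (M → Prop) → M → Prop
  | [], _ => False
  | P :: l, z => (P z ∧ N z) ∨ ((∀ y, P y → ¬ N y) ∧ FirstNew N l z)

omit [SetStr M] in
theorem FirstNew.spec {N : M → Prop} {l : List (M → Prop)} {z : M} (h : FirstNew N l z) :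
    N z ∧ ∃ P ∈ l, P z := by
  induction l with
  | nil => exact h.elim
  | cons P l ih =>
    rcases h with ⟨h1, h2⟩ | ⟨-, h⟩
    · exact ⟨h2, P, by simp, h1⟩
    · obtain ⟨h1, Q, hQ, h2⟩ := ih h
      exact ⟨h1, Q, by simp [hQ], h2⟩

omit [SetStr M] in
theorem exists_firstNew {N : M → Prop} {l : List (M → Prop)} {P : M → Prop} (hP : P ∈ l) {z : M}
    (hz : P z) (hN : N z) : ∃ y, FirstNew N l y := by
  induction l with
  | nil => simp at hP
  | cons Q l ih =>
    by_cases h : ∃ y, Q y ∧ N y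
    · obtain ⟨y, hy⟩ := h
      exact ⟨y, Or.inl hy⟩
    · push Not at h
      rcases List.mem_cons.1 hP with rfl | hP
      · exact absurd hN (h z hz)
      · obtain ⟨y, hy⟩ := ih hP
        exact ⟨y, Or.inr ⟨h, hy⟩⟩

omit [SetStr M] in
theorem FirstNew.unique {N : M → Prop} {l : List (M → Prop)}
    (hl : ∀ P ∈ l, ∀ y z, P y → P z → y = z) {y z : M} (hy : FirstNew N l y)
    (hz : FirstNew N l z) : y = z := by
  induction l with
  | nil => exact hy.elim
  | cons P l ih =>
    rcases hy with hy | hy <;> rcases hz with hz | hz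
    · exact hl P (by simp) y z hy.1 hz.1
    · exact absurd hy.2 (hz.1 y hy.1)
    · exact absurd hz.2 (hy.1 z hz.1)
    · exact ih (fun P hP => hl P (by simp [hP])) hy.2 hz.2

/-- The restriction of a relation, thought of as a partial function, to the elements of `ξ`. -/
def Below (W : M → M → Prop) (ξ : M) : M → M → Prop := fun η y => η ∈ₘ ξ ∧ W η y

/-- An operation on indices: `op W β γ z` says that `z` is the value of the operation at the indices
`β` and `γ`, where `W` is the enumeration, or a part of it. It depends on `W` only through the
values of `W` at `β` and `γ`, is single-valued if these are, and is definable when `W` is given by a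
set of ordered pairs (the first variable), restricted to a stage (the second one). -/
structure IsIndexOp (op : (M → M → Prop) → M → M → M → Prop) : Prop where
  congr : ∀ W W' β γ z, (∀ y, W β y ↔ W' β y) → (∀ y, W γ y ↔ W' γ y) → op W β γ z → op W' β γ z
  unique : ∀ W β γ y z, (∀ y z, W β y → W β z → y = z) → (∀ y z, W γ y → W γ z → y = z) →
    op W β γ y → op W β γ z → y = z
  defP : ∀ (L : FirstOrder.Language.{0, 0}) [L.Structure M] [DefStr L M],
    DefP L ∅ (fun v : Fin 5 → M => op (Below (App (v 0)) (v 1)) (v 2) (v 3) (v 4))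

/-- All members of the list are index operations. -/
class IndexOps (ops : List ((M → M → Prop) → M → M → M → Prop)) : Prop where
  out : ∀ op ∈ ops, IsIndexOp op

variable (ops : List ((M → M → Prop) → M → M → M → Prop))

/-- `z` is the first value at the indices `β` and `γ` that is not yet enumerated by `W`. -/
def Choice (W : M → M → Prop) (β γ z : M) : Prop :=
  FirstNew (fun y => ∀ η, ¬ W η y) (ops.map fun op => op W β γ) z

/-- `z` is the value chosen at the stage `ξ`, if `W` is the enumeration before that stage: the
first new value at the first pair `(β, γ)` of indices at which there is one. Pairs are compared
by the least `δ` with `β, γ ∈ δ`, and then lexicographically, so that every pair has only a set of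
predecessors. -/
def Step (W : M → M → Prop) (ξ z : M) : Prop := ∃ δ β γ,
  Least (fun δ => δ ∈ₘ ξ ∧ ∃ β γ, β ∈ₘ δ ∧ γ ∈ₘ δ ∧ ∃ y, Choice ops (Below W ξ) β γ y) δ ∧
  Least (fun β => β ∈ₘ δ ∧ ∃ γ, γ ∈ₘ δ ∧ ∃ y, Choice ops (Below W ξ) β γ y) β ∧
  Least (fun γ => γ ∈ₘ δ ∧ ∃ y, Choice ops (Below W ξ) β γ y) γ ∧
  Choice ops (Below W ξ) β γ z

/-- `w` is the enumeration before the stage `θ`. -/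
def Approx (θ w : M) : Prop :=
  ∀ p, p ∈ₘ w ↔ ∃ η z, η ∈ₘ θ ∧ IsOPair η z p ∧ Step ops (App w) η z

/-- `z` is enumerated at the stage `ξ`. -/
def Enum (ξ z : M) : Prop := ∃ θ w, IsOrd θ ∧ Approx ops θ w ∧ App w ξ z

section Definability

variable [hops : IndexOps ops] {L : FirstOrder.Language.{0, 0}} [L.Structure M] [DefStr L M]
  {A : Set M} {ι : Type} (w t s r z : (ι → M) → M) [hw : DefT L A w] [ht : DefT L A t] [hs : DefT L A s]
  [hr : DefT L A r] [hz : DefT L A z]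

theorem IsIndexOp.defP_subst {op : (M → M → Prop) → M → M → M → Prop} (h : IsIndexOp op) :
    DefP L A (fun v => op (Below (App (w v)) (t v)) (s v) (r v) (z v)) :=
  DefP.subst ((h.defP L).mono (empty_subset A)) (t := ![w, t, s, r, z])
    (by intro i; fin_cases i <;> assumption)

instance DefP.choice :
    DefP L A (fun v => Choice ops (Below (App (w v)) (t v)) (s v) (r v) (z v)) := by
  have key : ∀ l : List ((M → M → Prop) → M → M → M → Prop), (∀ op ∈ l, IsIndexOp op) →
      DefP L A (fun v => FirstNew (fun y => ∀ η, ¬ Below (App (w v)) (t v) η y)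
        (l.map fun op => op (Below (App (w v)) (t v)) (s v) (r v)) (z v)) := by
    intro l hl
    induction l with
    | nil => exact DefP.const False
    | cons op l ih =>
      have h1 := ih fun op hop => hl op (by simp [hop])
      have h2 {κ : Type} (w t s r z : (κ → M) → M) [DefT L A w] [DefT L A t] [DefT L A s]
        [DefT L A r] [DefT L A z] :
        DefP L A (fun v => op (Below (App (w v)) (t v)) (s v) (r v) (z v)) :=
        (hl op (by simp)).defP_subst w t s r z
      have h3 {κ : Type} (w t s z : (κ → M) → M) [DefT L A w] [DefT L A t] [DefT L A s]
        [DefT L A z] :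
        DefP L A (fun v => Below (App (w v)) (t v) (s v) (z v)) := by
        unfold Below; infer_instance
      simp only [List.map_cons, FirstNew]
      infer_instance
  exact key ops hops.out

instance DefP.step : DefP L A (fun v => Step ops (App (w v)) (t v) (s v)) := by
  unfold Step; infer_instance

instance DefP.approx : DefP L A (fun v => Approx ops (t v) (w v)) := by
  unfold Approx; infer_instance

instance DefP.enum : DefP L A (fun v => Enum ops (t v) (s v)) := by
  unfold Enum; infer_instance

end Definability

variable [hZF : Fact (IsModelZFWithoutRegularity M)] {ops} {W W' : M → M → Prop}
  {θ θ' w w' ξ ξ' η y z : M}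

omit hZF in
theorem Step.congr (h : ∀ η, η ∈ₘ ξ → ∀ y, W η y ↔ W' η y) :
    Step ops W ξ z ↔ Step ops W' ξ z := by
  have : Below W ξ = Below W' ξ := by
    funext η y
    exact propext (and_congr_right fun hη => h η hη y)
  simp only [Step, this]

variable [hops : IndexOps ops]

theorem Step.unique (hW : ∀ η, η ∈ₘ ξ → ∀ y z, W η y → W η z → y = z) (hy : Step ops W ξ y)
    (hz : Step ops W ξ z) : y = z := by
  obtain ⟨δ, β, γ, hδ, hβ, hγ, h⟩ := hy
  obtain ⟨δ', β', γ', hδ', hβ', hγ', h'⟩ := hz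
  obtain rfl := hδ.unique hδ'
  obtain rfl := hβ.unique hβ'
  obtain rfl := hγ.unique hγ'
  refine FirstNew.unique ?_ h h'
  intro P hP
  obtain ⟨op, hop, rfl⟩ := List.mem_map.1 hP
  exact fun y z => (hops.out op hop).unique _ _ _ _ _ (fun y z hy hz => hW _ hy.1 y z hy.2 hz.2)
    fun y z hy hz => hW _ hy.1 y z hy.2 hz.2

omit hops in
theorem Approx.app_iff (hw : Approx ops θ w) : App w η z ↔ η ∈ₘ θ ∧ Step ops (App w) η z := by
  rw [SetStr.app_iff, hw]
  simp only [isOPair_iff, opair_inj]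
  grind

theorem Approx.unique (hθ : IsOrd θ) (hw : Approx ops θ w) (hy : App w η y) (hz : App w η z) :
    y = z := by
  have hη := (hw.app_iff.1 hy).1
  refine IsOrd.induction (fun η => ∀ y z, App w η y → App w η z → y = z) (hθ.of_mem hη) ?_
    (by infer_instance) y z hy hz
  exact fun η _ ih y z hy hz => Step.unique ih (hw.app_iff.1 hy).2 (hw.app_iff.1 hz).2

omit hops in
theorem Approx.agree (hθ : IsOrd θ) (hθ' : IsOrd θ') (hw : Approx ops θ w)
    (hw' : Approx ops θ' w') (hη : η ∈ₘ θ) (hη' : η ∈ₘ θ') : App w η z ↔ App w' η z := by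
  refine IsOrd.induction (fun η => η ∈ₘ θ → η ∈ₘ θ' → ∀ z, App w η z ↔ App w' η z)
    (hθ.of_mem hη) ?_ (by infer_instance) hη hη' z
  intro η _ ih hη hη' z
  rw [hw.app_iff, hw'.app_iff]
  simp only [hη, hη', true_and]
  exact Step.congr fun ζ hζ => ih ζ hζ (hθ.trans hζ hη) (hθ'.trans hζ hη')

variable (ops) in
/-- Definable recursion: the enumeration before the stage `θ` consists of the values at the stages
`η ∈ θ`, computed from the enumerations before these. -/
theorem exists_approx (hθ : IsOrd θ) : ∃ w, Approx ops θ w := by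
  refine IsOrd.induction (fun θ => ∃ w, Approx ops θ w) hθ ?_
  intro θ hθ ih
  obtain ⟨b, hb⟩ := exists_image
    (fun η p => ∃ w z, Approx ops η w ∧ p = opair η z ∧ Step ops (App w) η z) θ (by
      rintro η hη p q ⟨w, z, hw, rfl, hz⟩ ⟨w', z', hw', rfl, hz'⟩
      have hη' := hθ.of_mem hη
      rw [Step.congr fun ζ hζ y => hw'.agree hη' hη' hw hζ hζ] at hz'
      exact congrArg _ (Step.unique (W := App w) (fun ζ _ y z => hw.unique hη') hz hz'))
  have hb' : ∀ {η w z}, η ∈ₘ θ → Approx ops η w → (App b η z ↔ Step ops (App w) η z) := by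
    intro η w z hη hw
    rw [app_iff, hb]
    have hη' := hθ.of_mem hη
    constructor
    · rintro ⟨_, -, w', z', hw', h, hz⟩
      obtain ⟨rfl, rfl⟩ := opair_inj.1 h
      exact (Step.congr fun ζ hζ y => hw'.agree hη' hη' hw hζ hζ).1 hz
    · exact fun hz => ⟨η, hη, w, z, hw, rfl, hz⟩
  have hb'' : ∀ {η z}, η ∈ₘ θ → (App b η z ↔ Step ops (App b) η z) := by
    intro η z hη
    obtain ⟨w, hw⟩ := ih η hη
    have hη' := hθ.of_mem hη
    rw [hb' hη hw]
    refine Step.congr fun ζ hζ y => ?_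
    obtain ⟨w', hw'⟩ := ih ζ (hθ.trans hζ hη)
    rw [hb' (hθ.trans hζ hη) hw', hw.app_iff]
    simp only [hζ, true_and]
    exact Step.congr fun κ hκ y =>
      hw.agree hη' (hη'.of_mem hζ) hw' (hη'.trans hκ hζ) hκ
  refine ⟨b, fun p => ⟨fun hp => ?_, ?_⟩⟩
  · obtain ⟨η, hη, w, z, hw, rfl, hz⟩ := (hb p).1 hp
    exact ⟨η, z, hη, isOPair_iff.2 rfl, (hb'' hη).1 ((hb' hη hw).2 hz)⟩
  · rintro ⟨η, z, hη, hp, hz⟩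
    rw [isOPair_iff.1 hp, ← app_iff]
    exact (hb'' hη).2 hz

omit hops in
theorem Approx.enum_iff (hθ : IsOrd θ) (hw : Approx ops θ w) (hξ : ξ ∈ₘ θ) :
    Enum ops ξ z ↔ App w ξ z :=
  ⟨fun ⟨_, _, hθ', hw', h⟩ => (hw'.agree hθ' hθ hw (hw'.app_iff.1 h).1 hξ).1 h,
    fun h => ⟨θ, w, hθ, hw, h⟩⟩

omit hops in
theorem Enum.isOrd (h : Enum ops ξ z) : IsOrd ξ := by
  obtain ⟨θ, w, hθ, hw, h⟩ := h
  exact hθ.of_mem (hw.app_iff.1 h).1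

theorem enum_iff_step (hξ : IsOrd ξ) : Enum ops ξ z ↔ Step ops (Enum ops) ξ z := by
  obtain ⟨θ, hθ, hξθ, -⟩ := exists_bound₂ hξ hξ
  obtain ⟨w, hw⟩ := exists_approx ops hθ
  rw [hw.enum_iff hθ hξθ, hw.app_iff]
  simp only [hξθ, true_and]
  exact Step.congr fun η hη y => (hw.enum_iff hθ (hθ.trans hη hξθ)).symm

theorem Enum.unique (hy : Enum ops ξ y) (hz : Enum ops ξ z) : y = z := by
  obtain ⟨θ, w, hθ, hw, h⟩ := hy
  exact hw.unique hθ h ((hw.enum_iff hθ (hw.app_iff.1 h).1).1 hz)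

/-- Nothing is enumerated twice, since only new values are chosen. -/
theorem Enum.injective (h : Enum ops ξ z) (h' : Enum ops ξ' z) : ξ = ξ' := by
  have key : ∀ {ξ ξ' : M}, Enum ops ξ z → Enum ops ξ' z → ¬ ξ ∈ₘ ξ' := by
    intro ξ ξ' h h' hξ
    obtain ⟨δ, β, γ, -, -, -, hc⟩ := (enum_iff_step h'.isOrd).1 h'
    exact hc.spec.1 ξ ⟨hξ, h⟩
  rcases h.isOrd.trichotomy h'.isOrd with h1 | h1 | h1
  · exact absurd h1 (key h h')
  · exact h1
  · exact absurd h1 (key h' h)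

/-- As long as a value at indices in `δ₀` is missing, every stage enumerates a value at indices in
`δ₀`. -/
theorem exists_enum_of_missing {op : (M → M → Prop) → M → M → M → Prop} (hop : op ∈ ops)
    {β γ δ₀ : M} (hδ₀ : IsOrd δ₀) (hβ : β ∈ₘ δ₀) (hγ : γ ∈ₘ δ₀) (hz : op (Enum ops) β γ z)
    (hn : ∀ ξ, ¬ Enum ops ξ z) (hξ : IsOrd ξ) (hδξ : δ₀ ∈ₘ ξ) :
    ∃ y, Enum ops ξ y ∧ ∃ op ∈ ops, ∃ β γ, β ∈ₘ δ₀ ∧ γ ∈ₘ δ₀ ∧ op (Enum ops) β γ y := by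
  obtain ⟨θ, hθ, hξθ, -⟩ := exists_bound₂ hξ hξ
  obtain ⟨w, hw⟩ := exists_approx ops hθ
  have hE : ∀ {η y}, η ∈ₘ ξ → (Below (App w) ξ η y ↔ Enum ops η y) := fun hη => by
    rw [hw.enum_iff hθ (hθ.trans hη hξθ), Below]
    simp [hη]
  have h0 : ∃ y, Choice ops (Below (App w) ξ) β γ y := by
    refine exists_firstNew (List.mem_map.2 ⟨op, hop, rfl⟩) (z := z) ?_ fun η hη =>
      hn η ((hE hη.1).1 hη)
    exact (hops.out op hop).congr _ _ _ _ _ (fun y => (hE (hξ.trans hβ hδξ)).symm)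
      (fun y => (hE (hξ.trans hγ hδξ)).symm) hz
  -- Since `δ₀` is a candidate, the least one is at most `δ₀`.
  obtain ⟨δ, hδ⟩ := exists_least (fun δ => δ ∈ₘ ξ ∧ ∃ β γ, β ∈ₘ δ ∧ γ ∈ₘ δ ∧
    ∃ y, Choice ops (Below (App w) ξ) β γ y) hδ₀ ⟨hδξ, β, γ, hβ, hγ, h0⟩
  have hδsub : ∀ {x}, x ∈ₘ δ → x ∈ₘ δ₀ := by
    intro x hx
    rcases hδ.1.trichotomy hδ₀ with h | rfl | h
    · exact hδ₀.trans hx h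
    · exact hx
    · exact absurd ⟨hδξ, β, γ, hβ, hγ, h0⟩ (hδ.2.2 _ h)
  obtain ⟨-, β₁, γ₁, hβ₁, hγ₁, h1⟩ := hδ.2.1
  obtain ⟨β₂, hβ₂⟩ := exists_least (fun β => β ∈ₘ δ ∧ ∃ γ, γ ∈ₘ δ ∧
    ∃ y, Choice ops (Below (App w) ξ) β γ y) (hδ.1.of_mem hβ₁) ⟨hβ₁, γ₁, hγ₁, h1⟩
  obtain ⟨hβδ, γ₂, hγ₂, h2⟩ := hβ₂.2.1
  obtain ⟨γ₃, hγ₃⟩ := exists_least (fun γ => γ ∈ₘ δ ∧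
    ∃ y, Choice ops (Below (App w) ξ) β₂ γ y) (hδ.1.of_mem hγ₂) ⟨hγ₂, h2⟩
  obtain ⟨hγδ, y, hy⟩ := hγ₃.2.1
  have hEy : Enum ops ξ y := by
    rw [hw.enum_iff hθ hξθ, hw.app_iff]
    exact ⟨hξθ, δ, β₂, γ₃, hδ, hβ₂, hγ₃, hy⟩
  obtain ⟨-, P, hP, hPy⟩ := hy.spec
  obtain ⟨op', hop', rfl⟩ := List.mem_map.1 hP
  refine ⟨y, hEy, op', hop', β₂, γ₃, hδsub hβδ, hδsub hγδ, ?_⟩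
  exact (hops.out op' hop').congr _ _ _ _ _ (fun y => hE (hξ.trans (hδsub hβδ) hδξ))
    (fun y => hE (hξ.trans (hδsub hγδ) hδξ)) hPy

/-- The values of the index operations at indices in `δ₀` form a set. -/
theorem exists_values {δ₀ : M} (hδ₀ : IsOrd δ₀) : ∃ s, ∀ op ∈ ops, ∀ β γ, β ∈ₘ δ₀ → γ ∈ₘ δ₀ →
    ∀ y, op (Enum ops) β γ y → y ∈ₘ s := by
  obtain ⟨w, hw⟩ := exists_approx ops hδ₀
  obtain ⟨a, ha⟩ := exists_subset_prod (fun _ => True) δ₀ δ₀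
  have h1 : ∀ op ∈ ops, ∃ s, ∀ β γ, β ∈ₘ δ₀ → γ ∈ₘ δ₀ → ∀ y, op (Enum ops) β γ y → y ∈ₘ s := by
    intro op hop
    have hdef {ι : Type} (w t s r z : (ι → M) → M) [DefT LMemE univ w] [DefT LMemE univ t]
      [DefT LMemE univ s] [DefT LMemE univ r] [DefT LMemE univ z] :
      DefP LMemE univ (fun v => op (Below (App (w v)) (t v)) (s v) (r v) (z v)) :=
      (hops.out op hop).defP_subst w t s r z
    obtain ⟨s, hs⟩ := exists_image
      (fun p y => ∃ β γ, p = opair β γ ∧ op (Below (App w) δ₀) β γ y) a (by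
        rintro p - y z ⟨β, γ, rfl, hy⟩ ⟨β', γ', h, hz⟩
        obtain ⟨rfl, rfl⟩ := opair_inj.1 h
        exact (hops.out op hop).unique _ _ _ _ _ (fun y z hy hz => hw.unique hδ₀ hy.2 hz.2)
          (fun y z hy hz => hw.unique hδ₀ hy.2 hz.2) hy hz)
    have hE : ∀ {η y}, η ∈ₘ δ₀ → (Enum ops η y ↔ Below (App w) δ₀ η y) := fun hη => by
      rw [hw.enum_iff hδ₀ hη, Below]
      simp [hη]
    refine ⟨s, fun β γ hβ hγ y hy => (hs y).2 ⟨opair β γ, (ha _).2 ⟨β, γ, hβ, hγ, trivial, rfl⟩,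
      β, γ, rfl, ?_⟩⟩
    exact (hops.out op hop).congr _ _ _ _ _ (fun y => hE hβ) (fun y => hE hγ) hy
  have h2 : ∀ l : List ((M → M → Prop) → M → M → M → Prop), (∀ op ∈ l, op ∈ ops) →
      ∃ s, ∀ op ∈ l, ∀ β γ, β ∈ₘ δ₀ → γ ∈ₘ δ₀ → ∀ y, op (Enum ops) β γ y → y ∈ₘ s := by
    intro l hl
    induction l with
    | nil => exact ⟨δ₀, by simp⟩
    | cons op l ih =>
      obtain ⟨s, hs⟩ := ih fun op hop => hl op (by simp [hop])
      obtain ⟨t, ht⟩ := h1 op (hl op (by simp))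
      obtain ⟨u, hu⟩ := exists_union s t
      refine ⟨u, fun op' hop' β γ hβ hγ y hy => (hu y).2 ?_⟩
      rcases List.mem_cons.1 hop' with rfl | hop'
      · exact Or.inr (ht β γ hβ hγ y hy)
      · exact Or.inl (hs op' hop' β γ hβ hγ y hy)
  exact h2 ops fun _ h => h

/-- The range of the enumeration is closed under the index operations. If a value at indices in
`δ₀` were missing, all stages beyond `δ₀` would inject into the set of such values. -/
theorem exists_enum {op : (M → M → Prop) → M → M → M → Prop} (hop : op ∈ ops) {β γ : M}
    (hβ : IsOrd β) (hγ : IsOrd γ) (hz : op (Enum ops) β γ z) : ∃ ξ, Enum ops ξ z := by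
  by_contra hn
  push Not at hn
  obtain ⟨δ₀, hδ₀, hβδ, hγδ⟩ := exists_bound₂ hβ hγ
  obtain ⟨s, hs⟩ := exists_values (ops := ops) hδ₀
  obtain ⟨t, ht⟩ := exists_image (fun y ξ => Enum ops ξ y) s (fun y _ ξ ξ' h h' => h.injective h')
  obtain ⟨ξ, hξ, hδξ, hξt⟩ := exists_not_mem_of_isOrd t hδ₀
  obtain ⟨y, hy, op', hop', β', γ', hβ', hγ', h⟩ :=
    exists_enum_of_missing hop hδ₀ hβδ hγδ hz hn hξ hδξ
  exact hξt ((ht ξ).2 ⟨y, hs op' hop' β' γ' hβ' hγ' y h, hy⟩)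

/-- Enumerated sets are ordinal definable, from their place in the enumeration. -/
theorem Enum.mem_OD {L : FirstOrder.Language.{0, 0}} [L.Structure M] [DefStr L M]
    (h : Enum ops ξ z) : z ∈ OD M L := by
  have : DefT L (Ords M) (fun _ : Fin 1 ⊕ Fin 1 → M => ξ) := DefT.const h.isOrd
  have hd : DefP L (Ords M) (fun v : Fin 1 → M => ∃ y, Enum ops ξ y ∧ v 0 ∈ₘ y) := by
    refine @DefP.ex _ _ _ _ _ _ ?_
    exact @DefP.and _ _ _ _ _ _ _ (DefP.enum ops (fun _ => ξ) (fun w => w (Sum.inr 0)))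
      inferInstance
  unfold OD Definable₁
  rw [mem_ofPred_eq]
  convert! hd.out using 1
  ext v
  exact ⟨fun hv => ⟨z, h, hv⟩, fun ⟨y, hy, hv⟩ => hy.unique h ▸ hv⟩

end Enumeration

/-! ### The closure under the Gödel operations -/

section Main

variable {M : Type*} [SetStr M]

/-- The operation `U_β`, regarded as an index operation. -/
def segmentOp (_ : M → M → Prop) (β _ z : M) : Prop := IsSegment β z

/-- The operation `G(W(β), W(γ))` on indices. -/
def indexOp (G : M → M → M → Prop) (W : M → M → Prop) (β γ z : M) : Prop :=
  ∃ X Y, W β X ∧ W γ Y ∧ G X Y z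

variable (M) in
/-- The index operations that correspond to the Gödel operations for `{∈, E}` and to the formation
of segments. -/
def godelIndexOps : List ((M → M → Prop) → M → M → M → Prop) :=
  segmentOp :: [GPair, GProd, GMem, GDiff, GInter, GUnion, GDom, GSwap, GTransp, GCycle, GRel].map
    indexOp

variable [hZF : Fact (IsModelZFWithoutRegularity M)]

theorem isIndexOp_segmentOp : IsIndexOp (segmentOp (M := M)) where
  congr _ _ _ _ _ _ _ h := h
  unique _ _ _ _ _ _ _ h h' := IsSegment.unique h h'
  defP L _ _ := by unfold segmentOp; infer_instance

theorem isIndexOp_indexOp {G : M → M → M → Prop} {P : M → M → M → Prop}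
    (hP : ∀ X Y Z, G X Y Z ↔ ∀ p, p ∈ₘ Z ↔ P X Y p)
    (hG : ∀ (L : FirstOrder.Language.{0, 0}) [L.Structure M] [DefStr L M],
      DefP L ∅ (fun v : Fin 3 → M => G (v 0) (v 1) (v 2))) : IsIndexOp (indexOp G) where
  congr := by
    rintro W W' β γ z hβ hγ ⟨X, Y, hX, hY, h⟩
    exact ⟨X, Y, (hβ X).1 hX, (hγ Y).1 hY, h⟩
  unique := by
    rintro W β γ y z hβ hγ ⟨X, Y, hX, hY, h⟩ ⟨X', Y', hX', hY', h'⟩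
    obtain rfl := hβ X X' hX hX'
    obtain rfl := hγ Y Y' hY hY'
    exact ext_of ((hP _ _ _).1 h) ((hP _ _ _).1 h')
  defP L _ _ := by
    have h {ι : Type} (t s r : (ι → M) → M) [DefT L ∅ t] [DefT L ∅ s] [DefT L ∅ r] :
      DefP L ∅ (fun v => G (t v) (s v) (r v)) := DefP.subst₃ (hG L) t s r
    unfold indexOp Below
    infer_instance

instance : IndexOps (godelIndexOps M) where
  out := by
    simp only [godelIndexOps, List.map_cons, List.map_nil, List.forall_mem_cons,
      List.not_mem_nil, false_imp_iff, implies_true, and_true]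
    refine ⟨isIndexOp_segmentOp, ?_, ?_, ?_, ?_, ?_, ?_, ?_, ?_, ?_, ?_, ?_⟩
    · exact isIndexOp_indexOp (fun X Y Z => Iff.rfl) fun L _ _ => by
        unfold GPair; infer_instance
    · exact isIndexOp_indexOp (fun X Y Z => Iff.rfl) fun L _ _ => by
        unfold GProd; infer_instance
    · exact isIndexOp_indexOp (fun X Y Z => Iff.rfl) fun L _ _ => by
        unfold GMem; infer_instance
    · exact isIndexOp_indexOp (fun X Y Z => Iff.rfl) fun L _ _ => by
        unfold GDiff; infer_instance
    · exact isIndexOp_indexOp (fun X Y Z => Iff.rfl) fun L _ _ => by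
        unfold GInter; infer_instance
    · exact isIndexOp_indexOp (fun X Y Z => Iff.rfl) fun L _ _ => by
        unfold GUnion; infer_instance
    · exact isIndexOp_indexOp (fun X Y Z => Iff.rfl) fun L _ _ => by
        unfold GDom; infer_instance
    · exact isIndexOp_indexOp (fun X Y Z => Iff.rfl) fun L _ _ => by
        unfold GSwap; infer_instance
    · exact isIndexOp_indexOp (fun X Y Z => Iff.rfl) fun L _ _ => by
        unfold GTransp IsTriple; infer_instance
    · exact isIndexOp_indexOp (fun X Y Z => Iff.rfl) fun L _ _ => by
        unfold GCycle IsTriple; infer_instance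
    · exact isIndexOp_indexOp (fun X Y Z => Iff.rfl) fun L _ _ => by
        unfold GRel; infer_instance

omit hZF in
theorem indexOp_mem {G : M → M → M → Prop} (hG : G ∈ godelOpsE M) :
    indexOp G ∈ godelIndexOps M := by
  refine List.mem_cons_of_mem _ (List.mem_map_of_mem ?_)
  simp only [godelOpsE, godelOps, mem_insert_iff, mem_singleton_iff] at hG
  simp only [List.mem_cons, List.not_mem_nil, or_false]
  tauto

variable {L : FirstOrder.Language.{0, 0}} [L.Structure M] [DefStr L M]

/-- The range of the enumeration is one of the classes that define the closure, and its members are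
ordinal definable. That it is closed under the operation for `E` as well does no harm when `ops` are
the classical operations. -/
theorem cl_subset_OD {ops : Set (M → M → M → Prop)} (hops : ops ⊆ godelOpsE M) :
    cl L ops (Segments M) ⊆ OD M L := by
  intro x hx
  have hdef : DefP L univ (fun v : Fin 1 → M => ∃ ξ, Enum (godelIndexOps M) ξ (v 0)) :=
    inferInstance
  suffices x ∈ {z | ∃ ξ, Enum (godelIndexOps M) ξ z} by
    obtain ⟨ξ, hξ⟩ := this
    exact hξ.mem_OD
  refine hx _ hdef.out ?_ ?_
  · rintro u ⟨α, hα, hu⟩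
    exact exists_enum (op := segmentOp) (by simp [godelIndexOps]) hα hα hu
  · rintro G hG X Y Z ⟨β, hX⟩ ⟨γ, hY⟩ h
    exact exists_enum (indexOp_mem (hops hG)) hX.isOrd hY.isOrd ⟨X, Y, hX, hY, h⟩

theorem OD_eq_cl [hBF : Fact (IsBestFounded M)] [L.IsRelational]
    {ops : Set (M → M → M → Prop)} (h1 : godelOps M ⊆ ops) (h2 : ops ⊆ godelOpsE M)
    (hL : ∀ C : Set M, Segments M ⊆ C → ClosedUnder ops C → LocalSymbols L C) :
    OD M L = cl L ops (Segments M) := by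
  refine (Subset.antisymm ?_ (cl_subset_OD h2))
  intro a ha C _ hS hC
  have hC' : ClosedUnder (godelOps M) C := fun G hG => hC G (h1 hG)
  exact mem_of_definable hS hC' (hL C hS hC) (ords_subset hS hC' (hL C hS hC)) ha

end Main

end SetStr

theorem mainTheorem2 {M : Type*} [SetStr M]
    (hZF : SetStr.IsModelZFWithoutRegularity M) (hBF : SetStr.IsBestFounded M) :
    SetStr.OD M LMemE = SetStr.cl LMemE (SetStr.godelOpsE M) (SetStr.Segments M) ∧
    ((∅ : Set M).Definable₂ LMem {p : M × M | SetStr.rel p.1 p.2} →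
      SetStr.OD M LMem = SetStr.cl LMem (SetStr.godelOps M) (SetStr.Segments M)) := by
  have : Fact (SetStr.IsModelZFWithoutRegularity M) := ⟨hZF⟩
  have : Fact (SetStr.IsBestFounded M) := ⟨hBF⟩
  have : LMemE.IsRelational := fun _ => inferInstanceAs (IsEmpty Empty)
  have : LMem.IsRelational := fun _ => inferInstanceAs (IsEmpty Empty)
  have hsub : SetStr.godelOps M ⊆ SetStr.godelOpsE M := Set.subset_insert _ _
  refine ⟨SetStr.OD_eq_cl hsub subset_rfl fun C hS hC => ?_, fun hE => ?_⟩
  · have hC' : SetStr.ClosedUnder (SetStr.godelOps M) C := fun G hG => hC G (hsub hG)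
    rintro _ (_ | _)
    · exact ⟨_, 0, 1, fun v => Iff.rfl, SetStr.Local₂.mem_rel hS hC'⟩
    · exact ⟨_, 0, 1, fun v => Iff.rfl, SetStr.Local₂.rel_rel hS hC⟩
  · have : SetStr.DefStr LMem M :=
      { mem := by
          refine Set.empty_definable_iff.2 ⟨FirstOrder.Language.Relations.formula₂ (L := LMem)
            MemSymbol.mem (FirstOrder.Language.Term.var 0) (FirstOrder.Language.Term.var 1), ?_⟩
          ext v
          exact Iff.rfl
        rel := hE }
    refine SetStr.OD_eq_cl subset_rfl hsub fun C hS hC => ?_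
    rintro _ (_ | _)
    exact ⟨_, 0, 1, fun v => Iff.rfl, SetStr.Local₂.mem_rel hS hC⟩
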